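/- Let $N\ge 2$, let $\Omega\subset\mathbb R^N$ be a bounded domain with smooth ($C^\infty$) boundary, $\delta(x)=\mathrm{dist}(x,\partial\Omega)$, and $\Omega_\rho=\{x\in\Omega:\delta(x)<\rho\}$ for $\rho>0$. Let $\mu\le 1/4$, $\mathcal L_\mu=-\Delta-\mu\,\delta^{-2}$ and $\beta_\pm=\frac12\pm\sqrt{\frac14-\mu}$. All limits $x\to\partial\Omega$ are taken along $x\in\Omega$ with $\delta(x)\to0$, and $\limsup$'s take values in $[-\infty,\infty]$. A *local sub-harmonic* of $\mathcal L_\mu$ is a real-valued function $h$ such that for some $\rho>0$ one has $h\in H^1_{loc}(\Omega_\rho)\cap C(\Omega_\rho)$ and $$\int_{\Omega_\rho}\nabla h\cdot\nabla\varphi\,dx-\int_{\Omega_\rho}\frac{\mu}{\delta^2}h\varphi\,dx\le 0\qquad\text{for all } 0\le\varphi\in H^1_c(\Omega_\rho),$$ where $H^1_c(\Omega_\rho)$ is the space of functions in $H^1(\Omega_\rho)$ with compact support in $\Omega_\rho$; a *local super-harmonic* is defined with $\ge$ instead of $\le$. It is *positive* if it is $>0$ in some $\Omega_\rho$. A local sub-harmonic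 $H$ is *large* if $\limsup_{x\to\partial\Omega}H/\overline h>0$ for every positive local super-harmonic $\overline h$ of $\mathcal L_\mu$; a local sub-harmonic that is not large is called *small*. **Theorem.** (i) If $\mu<1/4$, then every small local sub-harmonic $h$ and every large local sub-harmonic $H$ of $\mathcal L_\mu$ satisfy $$\limsup_{x\to\partial\Omega}\frac{h}{\delta^{\beta_+}}<\infty,\qquad \limsup_{x\to\partial\Omega}\frac{H}{\delta^{\beta_-}}>0.$$ These orders are sharp: there are a small local sub-harmonic $h_0$ and a large local sub-harmonic $H_0$ with $\lim_{x\to\partial\Omega}h_0/\delta^{\beta_+}=1$ and $\lim_{x\to\partial\Omega}H_0/\delta^{\beta_-}=1$. (ii) If $\mu=1/4$, then every small local sub-harmonic $h$ and every large local sub-harmonic $H$ of $\mathcal L_\mu$ satisfy $$\limsup_{x\to\partial\Omega}\frac{h}{\delta^{1/2}}<\infty,\qquad \limsup_{x\to\partial\Omega}\frac{H}{\delta^{1/2}\log\frac1\delta}>0.$$ These orders are sharp: there are a small local sub-harmonic $h_0$ and a large local sub-harmonic $H_0$ with $\lim_{x\to\partial\Omega}h_0/\delta^{1/2}=1$ and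 $\lim_{x\to\partial\Omega}H_0/(\delta^{1/2}\log\frac1\delta)=1$. -/

import Mathlib

open Set Filter Topology MeasureTheory
open scoped ContDiff

noncomputable section

namespace HardyPotential

variable {N : ℕ}

/-- Bounded domain (nonempty connected open set) with `C^∞` boundary: near each boundary point, `Ω`
is the positivity set of a smooth function whose differential does not vanish at that point. -/
structure IsBoundedSmoothDomain (Ω : Set (EuclideanSpace ℝ (Fin N))) : Prop where
  isOpen : IsOpen Ω
  isConnected : IsConnected Ω
  isBounded : Bornology.IsBounded Ω
  smooth_boundary : ∀ p ∈ frontier Ω, ∃ U : Set (EuclideanSpace ℝ (Fin N)), IsOpen U ∧ p ∈ U ∧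
    ∃ r : EuclideanSpace ℝ (Fin N) → ℝ, ContDiffOn ℝ ∞ r U ∧ fderiv ℝ r p ≠ 0 ∧
      ∀ x ∈ U, (x ∈ Ω ↔ 0 < r x)

/-- The distance `δ(x) = dist(x, ∂Ω)`. -/
def bdryDist (Ω : Set (EuclideanSpace ℝ (Fin N))) (x : EuclideanSpace ℝ (Fin N)) : ℝ :=
  Metric.infDist x (frontier Ω)

/-- The set `Ω_ρ = {x ∈ Ω : δ(x) < ρ}`. -/
def bdryStrip (Ω : Set (EuclideanSpace ℝ (Fin N))) (ρ : ℝ) : Set (EuclideanSpace ℝ (Fin N)) :=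
  {x ∈ Ω | bdryDist Ω x < ρ}

/-- The filter `x → ∂Ω`: points `x` of `Ω` with `δ(x) → 0`. -/
def toBdry (Ω : Set (EuclideanSpace ℝ (Fin N))) : Filter (EuclideanSpace ℝ (Fin N)) :=
  comap (bdryDist Ω) (𝓝 0) ⊓ 𝓟 Ω

/-- `g` is the weak (distributional) gradient of `u` in the open set `G`. -/
structure HasWeakGradientOn (G : Set (EuclideanSpace ℝ (Fin N)))
    (u : EuclideanSpace ℝ (Fin N) → ℝ)
    (g : EuclideanSpace ℝ (Fin N) → EuclideanSpace ℝ (Fin N)) : Prop where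
  locallyIntegrableOn : LocallyIntegrableOn u G volume
  locallyIntegrableOn_gradient : LocallyIntegrableOn g G volume
  integral_eq : ∀ η : EuclideanSpace ℝ (Fin N) → ℝ, ContDiff ℝ ∞ η → HasCompactSupport η →
    tsupport η ⊆ G → ∀ v : EuclideanSpace ℝ (Fin N),
      ∫ x in G, u x * fderiv ℝ η x v = - ∫ x in G, inner ℝ (g x) v * η x

/-- `u ∈ H¹_loc(G)`, with weak gradient `g`. -/
structure MemH1Loc (G : Set (EuclideanSpace ℝ (Fin N)))
    (u : EuclideanSpace ℝ (Fin N) → ℝ)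
    (g : EuclideanSpace ℝ (Fin N) → EuclideanSpace ℝ (Fin N)) : Prop where
  hasWeakGradientOn : HasWeakGradientOn G u g
  memLp : ∀ K ⊆ G, IsCompact K → MemLp u 2 (volume.restrict K)
  memLp_gradient : ∀ K ⊆ G, IsCompact K → MemLp g 2 (volume.restrict K)

/-- `φ ∈ H¹_c(G)`, with weak gradient `ψ`: a function in `H¹(G)` that vanishes almost everywhere
outside some compact subset of `G`. -/
structure MemH1Compact (G : Set (EuclideanSpace ℝ (Fin N)))
    (φ : EuclideanSpace ℝ (Fin N) → ℝ)
    (ψ : EuclideanSpace ℝ (Fin N) → EuclideanSpace ℝ (Fin N)) : Prop where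
  hasWeakGradientOn : HasWeakGradientOn G φ ψ
  memLp : MemLp φ 2 (volume.restrict G)
  memLp_gradient : MemLp ψ 2 (volume.restrict G)
  compact_support : ∃ K ⊆ G, IsCompact K ∧ ∀ᵐ x ∂(volume.restrict G), x ∉ K → φ x = 0

/-- The weak form `∫_G ∇h · ∇φ dx - ∫_G (μ / δ²) h φ dx` of `-Δ - μ / δ²`,
where `g = ∇h` and `ψ = ∇φ`. -/
def weakForm (Ω : Set (EuclideanSpace ℝ (Fin N))) (μ : ℝ) (G : Set (EuclideanSpace ℝ (Fin N)))
    (h : EuclideanSpace ℝ (Fin N) → ℝ)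
    (g : EuclideanSpace ℝ (Fin N) → EuclideanSpace ℝ (Fin N))
    (φ : EuclideanSpace ℝ (Fin N) → ℝ)
    (ψ : EuclideanSpace ℝ (Fin N) → EuclideanSpace ℝ (Fin N)) : ℝ :=
  (∫ x in G, inner ℝ (g x) (ψ x)) - ∫ x in G, μ / bdryDist Ω x ^ 2 * h x * φ x

/-- `h ∈ H¹_loc(G) ∩ C(G)` is a sub-harmonic of `-Δ - μ / δ²` in the open set `G ⊆ Ω`. -/
def IsSubharmonicIn (Ω : Set (EuclideanSpace ℝ (Fin N))) (μ : ℝ)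
    (G : Set (EuclideanSpace ℝ (Fin N))) (h : EuclideanSpace ℝ (Fin N) → ℝ) : Prop :=
  ContinuousOn h G ∧ ∃ g, MemH1Loc G h g ∧
    ∀ φ ψ, MemH1Compact G φ ψ → (∀ᵐ x ∂(volume.restrict G), 0 ≤ φ x) →
      weakForm Ω μ G h g φ ψ ≤ 0

/-- `h ∈ H¹_loc(G) ∩ C(G)` is a super-harmonic of `-Δ - μ / δ²` in the open set `G ⊆ Ω`. -/
def IsSuperharmonicIn (Ω : Set (EuclideanSpace ℝ (Fin N))) (μ : ℝ)
    (G : Set (EuclideanSpace ℝ (Fin N))) (h : EuclideanSpace ℝ (Fin N) → ℝ) : Prop :=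
  ContinuousOn h G ∧ ∃ g, MemH1Loc G h g ∧
    ∀ φ ψ, MemH1Compact G φ ψ → (∀ᵐ x ∂(volume.restrict G), 0 ≤ φ x) →
      0 ≤ weakForm Ω μ G h g φ ψ

/-- Local sub-harmonic: sub-harmonic in some strip `Ω_ρ`, `ρ > 0`
(the values outside the strip are irrelevant). -/
def IsLocalSubharmonic (Ω : Set (EuclideanSpace ℝ (Fin N))) (μ : ℝ)
    (h : EuclideanSpace ℝ (Fin N) → ℝ) : Prop :=
  ∃ ρ : ℝ, 0 < ρ ∧ IsSubharmonicIn Ω μ (bdryStrip Ω ρ) h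

/-- Positive local super-harmonic: super-harmonic and positive in some strip `Ω_ρ`, `ρ > 0`. -/
def IsPositiveLocalSuperharmonic (Ω : Set (EuclideanSpace ℝ (Fin N))) (μ : ℝ)
    (k : EuclideanSpace ℝ (Fin N) → ℝ) : Prop :=
  ∃ ρ : ℝ, 0 < ρ ∧ IsSuperharmonicIn Ω μ (bdryStrip Ω ρ) k ∧ ∀ x ∈ bdryStrip Ω ρ, 0 < k x

/-- `limsup_{x → ∂Ω} f(x) / w(x)`, as an extended real number. -/
def limsupRatio (Ω : Set (EuclideanSpace ℝ (Fin N))) (f w : EuclideanSpace ℝ (Fin N) → ℝ) :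
    EReal :=
  limsup (fun x => ((f x / w x : ℝ) : EReal)) (toBdry Ω)

/-- Large local sub-harmonic: `limsup_{x → ∂Ω} H / k > 0` for every positive local
super-harmonic `k`. -/
def IsLargeSubharmonic (Ω : Set (EuclideanSpace ℝ (Fin N))) (μ : ℝ)
    (H : EuclideanSpace ℝ (Fin N) → ℝ) : Prop :=
  IsLocalSubharmonic Ω μ H ∧
    ∀ k, IsPositiveLocalSuperharmonic Ω μ k → 0 < limsupRatio Ω H k

/-- Small local sub-harmonic: a local sub-harmonic that is not large. -/
def IsSmallSubharmonic (Ω : Set (EuclideanSpace ℝ (Fin N))) (μ : ℝ)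
    (h : EuclideanSpace ℝ (Fin N) → ℝ) : Prop :=
  IsLocalSubharmonic Ω μ h ∧ ¬ IsLargeSubharmonic Ω μ h

/-- The larger root `β₊` of `β (1 - β) = μ`. -/
def betaPlus (μ : ℝ) : ℝ := 1 / 2 + Real.sqrt (1 / 4 - μ)

/-- The smaller root `β₋` of `β (1 - β) = μ`. -/
def betaMinus (μ : ℝ) : ℝ := 1 / 2 - Real.sqrt (1 / 4 - μ)

end HardyPotential

end

/-!
Near the boundary the distance `δ` is smooth, satisfies `|∇δ| = 1`, and has bounded Laplacian
(`IsBoundedSmoothDomain.exists_strip_smooth`): the normal map `(q, l) ↦ (q + l ∇r(q), r(q))` built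
from a local defining function `r` is a local diffeomorphism, and a point close to the boundary is
reached from its nearest boundary point along the normal. Hence, for a function `f` of one variable,
`Δ(f(δ)) + μ δ⁻² f(δ)` is `f''(δ) + μ δ⁻² f(δ)` up to a term bounded by a multiple of `|f'(δ)|`. The
Euler equation `f'' + μ t⁻² f = 0` is solved by `t ^ β₊` and `t ^ β₋`, or by `t ^ (1/2)` and
`t ^ (1/2) log (1/t)` when `μ = 1/4`. Adding to a solution a suitable multiple of a higher
power `t ^ b`, with either sign, absorbs the curvature term, and yields both a strict super-harmonic
and a sub-harmonic asymptotic to `f(δ)` (`IsEulerProfile.exists_super`,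
`IsEulerProfile.exists_sub`).

Everything else is comparison. Let `h` be small, so that `limsup h / k ≤ 0` for some positive
super-harmonic `k`, and let `S` be the super-harmonic barrier asymptotic to the decaying profile. On
a level set of `δ` one has `h ≤ C S`, and `h ≤ ε k` close to the boundary; the maximum principle
gives `h ≤ C S + ε k` in between, with `C` independent of `ε`, hence `h ≤ C S`
(`exists_le_mul_barrier`). This bounds small sub-harmonics, and shows that the sub-harmonic
asymptotic to the dominant profile cannot be small. A large sub-harmonic, compared with the
super-harmonic barrier of the dominant profile, has at least the order of that profile; and the
sub-harmonic asymptotic to the decaying profile is small, because its quotient by this same barrier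
tends to `0`.

The maximum principle (`nonpos_of_subsolution`) is proved for the weak formulation. A sub-solution
`u` is written as `z S` with `S` a positive strict super-solution and is tested against
`S * max z 0 ^ 2`; this leaves the nonnegative integrals of `2 S ^ 2 * max z 0 * |∇z| ^ 2` and of
`(-ΔS - V S) * S * max z 0 ^ 3`, whose sum is at most `0`. That the test function is admissible
rests on the chain rule for continuous Sobolev functions (`MemH1Loc.comp_hasDerivAt`), obtained by
mollification.
-/

noncomputable section

namespace HardyPotential

open scoped RealInnerProductSpace Laplacian Gradient Convolution

variable {N : ℕ}

/-! ### Elementary properties of the distance to the boundary -/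

theorem continuous_bdryDist (Ω : Set (EuclideanSpace ℝ (Fin N))) : Continuous (bdryDist Ω) :=
  Metric.continuous_infDist_pt _

namespace IsBoundedSmoothDomain

variable {Ω : Set (EuclideanSpace ℝ (Fin N))}

theorem frontier_nonempty (hN : 2 ≤ N) (hΩ : IsBoundedSmoothDomain Ω) : (frontier Ω).Nonempty := by
  have : Nonempty (Fin N) := ⟨⟨0, by omega⟩⟩
  rw [Set.nonempty_iff_ne_empty, Ne, frontier_eq_empty_iff]
  rintro (h | h)
  · exact hΩ.isConnected.nonempty.ne_empty h
  · exact NormedSpace.unbounded_univ ℝ (EuclideanSpace ℝ (Fin N)) (h ▸ hΩ.isBounded)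

theorem isCompact_frontier (hΩ : IsBoundedSmoothDomain Ω) : IsCompact (frontier Ω) :=
  Metric.isCompact_of_isClosed_isBounded isClosed_frontier
    (hΩ.isBounded.closure.subset frontier_subset_closure)

theorem bdryDist_pos (hN : 2 ≤ N) (hΩ : IsBoundedSmoothDomain Ω)
    {x : EuclideanSpace ℝ (Fin N)} (hx : x ∈ Ω) : 0 < bdryDist Ω x := by
  refine (isClosed_frontier.notMem_iff_infDist_pos (hΩ.frontier_nonempty hN)).1 fun h => ?_
  exact (hΩ.isOpen.inter_frontier_eq.subset ⟨hx, h⟩ : x ∈ (∅ : Set _)).elim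

theorem isOpen_bdryStrip (hΩ : IsBoundedSmoothDomain Ω) (ρ : ℝ) : IsOpen (bdryStrip Ω ρ) :=
  hΩ.isOpen.inter (isOpen_lt (continuous_bdryDist Ω) continuous_const)

theorem exists_nearest (hN : 2 ≤ N) (hΩ : IsBoundedSmoothDomain Ω)
    (x : EuclideanSpace ℝ (Fin N)) : ∃ q ∈ frontier Ω, bdryDist Ω x = dist x q :=
  isClosed_frontier.exists_infDist_eq_dist (hΩ.frontier_nonempty hN) x

/-- The ball around `x ∈ Ω` of radius `δ(x)` lies in `Ω`: it is connected and misses `∂Ω`. -/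
theorem ball_bdryDist_subset (hΩ : IsBoundedSmoothDomain Ω)
    {x : EuclideanSpace ℝ (Fin N)} (hx : x ∈ Ω) :
    Metric.ball x (bdryDist Ω x) ⊆ Ω := by
  intro y hy
  by_contra hyΩ
  have hmiss : ∀ z ∈ Metric.ball x (bdryDist Ω x), z ∉ frontier Ω := fun z hz hzf =>
    absurd (Metric.infDist_le_dist_of_mem hzf) (not_le.2 (by
      rw [dist_comm]; exact Metric.mem_ball.1 hz))
  have hout : ∀ z ∈ Metric.ball x (bdryDist Ω x), z ∉ Ω → z ∈ (closure Ω)ᶜ := fun z hz hzΩ hzc =>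
    hmiss z hz ⟨hzc, by rwa [hΩ.isOpen.interior_eq]⟩
  obtain ⟨z, -, hzΩ, hzc⟩ := (convex_ball x (bdryDist Ω x)).isPreconnected Ω (closure Ω)ᶜ
    hΩ.isOpen isClosed_closure.isOpen_compl
    (fun z hz => (em (z ∈ Ω)).imp id (hout z hz))
    ⟨x, Metric.mem_ball_self (Metric.pos_of_mem_ball hy), hx⟩ ⟨y, hy, hout y hy hyΩ⟩
  exact hzc (subset_closure hzΩ)

theorem isCompact_bdryDist_Icc (hΩ : IsBoundedSmoothDomain Ω) {a : ℝ} (ha : 0 < a) (b : ℝ) :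
    IsCompact {x ∈ Ω | a ≤ bdryDist Ω x ∧ bdryDist Ω x ≤ b} := by
  have hs : {x ∈ Ω | a ≤ bdryDist Ω x ∧ bdryDist Ω x ≤ b} =
      closure Ω ∩ (bdryDist Ω ⁻¹' Icc a b) := by
    ext x
    refine ⟨fun h => ⟨subset_closure h.1, h.2⟩, fun h => ⟨?_, h.2⟩⟩
    by_contra hx
    have hf : x ∈ frontier Ω := ⟨h.1, by rwa [hΩ.isOpen.interior_eq]⟩
    have : bdryDist Ω x = 0 := Metric.infDist_zero_of_mem hf
    have := h.2.1
    linarith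
  rw [hs]
  exact hΩ.isBounded.isCompact_closure.inter_right
    (isClosed_Icc.preimage (continuous_bdryDist Ω))

/-- Points of `Ω` are found at every small positive distance from `∂Ω`. -/
theorem exists_bdryDist_eq (hN : 2 ≤ N) (hΩ : IsBoundedSmoothDomain Ω) :
    ∃ R > 0, ∀ t ∈ Ioo 0 R, ∃ x ∈ Ω, bdryDist Ω x = t := by
  obtain ⟨x₀, hx₀⟩ := hΩ.isConnected.nonempty
  refine ⟨bdryDist Ω x₀, hΩ.bdryDist_pos hN hx₀, fun t ht => ?_⟩
  obtain ⟨p, hp⟩ := hΩ.frontier_nonempty hN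
  obtain ⟨y, hy, hyd⟩ := Metric.mem_closure_iff.1 (frontier_subset_closure hp) t ht.1
  have hyt : bdryDist Ω y < t :=
    (Metric.infDist_le_dist_of_mem hp).trans_lt (by rwa [dist_comm])
  exact hΩ.isConnected.isPreconnected.intermediate_value hy hx₀
    (continuous_bdryDist Ω).continuousOn ⟨hyt.le, ht.2.le⟩

end IsBoundedSmoothDomain

theorem hasBasis_toBdry (Ω : Set (EuclideanSpace ℝ (Fin N))) :
    (toBdry Ω).HasBasis (fun ρ : ℝ => 0 < ρ) (bdryStrip Ω) := by
  refine ⟨fun s => ?_⟩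
  have h := ((Metric.nhds_basis_ball (x := (0 : ℝ))).comap (bdryDist Ω)).inf_principal Ω
  rw [toBdry, h.mem_iff]
  refine exists_congr fun ρ => and_congr_right fun _ => ?_
  have : bdryDist Ω ⁻¹' Metric.ball 0 ρ ∩ Ω = bdryStrip Ω ρ := by
    ext x
    simp only [mem_inter_iff, mem_preimage, Metric.mem_ball, Real.dist_eq, sub_zero, bdryStrip,
      mem_ofPred_eq]
    constructor
    · exact fun h => ⟨h.2, (le_abs_self _).trans_lt h.1⟩
    · exact fun h => ⟨(abs_of_nonneg (Metric.infDist_nonneg : 0 ≤ bdryDist Ω x)).trans_lt h.2, h.1⟩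
  rw [this]

theorem tendsto_bdryDist_toBdry (hN : 2 ≤ N) {Ω : Set (EuclideanSpace ℝ (Fin N))}
    (hΩ : IsBoundedSmoothDomain Ω) : Tendsto (bdryDist Ω) (toBdry Ω) (𝓝[>] 0) := by
  refine tendsto_nhdsWithin_iff.2 ⟨tendsto_comap.mono_left inf_le_left, ?_⟩
  filter_upwards [mem_inf_of_right (mem_principal_self Ω)] with x hx
  exact hΩ.bdryDist_pos hN hx

theorem toBdry_neBot (hN : 2 ≤ N) {Ω : Set (EuclideanSpace ℝ (Fin N))}
    (hΩ : IsBoundedSmoothDomain Ω) : (toBdry Ω).NeBot := by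
  refine (hasBasis_toBdry Ω).neBot_iff.2 fun {ρ} hρ => ?_
  obtain ⟨R, hR, h⟩ := hΩ.exists_bdryDist_eq hN
  obtain ⟨x, hx, hxt⟩ := h (min ρ R / 2) ⟨by positivity, by
    have := min_le_right ρ R; linarith⟩
  exact ⟨x, hx, by rw [hxt]; have := min_le_left ρ R; linarith⟩

/-! ### Smoothness of the distance near the boundary -/

/-- If `⟪a, w⟫ ≥ 0` whenever `⟪n, w⟫ > 0`, then `n` is a nonnegative multiple of `a`. -/
theorem exists_eq_smul_of_halfspace {E : Type*} [NormedAddCommGroup E] [InnerProductSpace ℝ E]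
    {n a : E} (hn : n ≠ 0) (ha : a ≠ 0) (h : ∀ w, 0 < ⟪n, w⟫ → 0 ≤ ⟪a, w⟫) :
    ∃ l : ℝ, 0 ≤ l ∧ n = l • a := by
  have hnn : 0 < ⟪n, n⟫ := real_inner_self_pos.2 hn
  have hb : 0 ≤ ⟪a, n⟫ := h n hnn
  have h0 : ∀ w, ⟪n, w⟫ = 0 → 0 ≤ ⟪a, w⟫ := by
    intro w hw
    refine ge_of_tendsto (x := 𝓝[>] (0 : ℝ)) (f := fun e : ℝ => ⟪a, w⟫ + e * ⟪a, n⟫) ?_ ?_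
    · have : Tendsto (fun e : ℝ => ⟪a, w⟫ + e * ⟪a, n⟫) (𝓝 0) (𝓝 (⟪a, w⟫ + 0 * ⟪a, n⟫)) :=
        Continuous.tendsto (by fun_prop) 0
      simpa using this.mono_left nhdsWithin_le_nhds
    · filter_upwards [self_mem_nhdsWithin] with e he
      have := h (w + e • n) (by
        rw [inner_add_right, inner_smul_right, hw, zero_add]; exact mul_pos he hnn)
      rwa [inner_add_right, inner_smul_right] at this
  -- the component of `a` orthogonal to `n` vanishes
  set w := ⟪a, n⟫ • n - ⟪n, n⟫ • a with hw
  have hnw : ⟪n, w⟫ = 0 := by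
    rw [hw, inner_sub_right, inner_smul_right, inner_smul_right, real_inner_comm n a]; ring
  have hww : ⟪w, w⟫ = - (⟪n, n⟫ * ⟪a, w⟫) := by
    conv_lhs => rw [hw, inner_sub_left, inner_smul_left, inner_smul_left, ← hw, hnw]
    simp
  have hw0 : w = 0 := by
    by_contra hne
    have h1 := real_inner_self_pos.2 hne
    have h2 := mul_nonneg hnn.le (h0 w hnw)
    linarith
  have hna : ⟪n, n⟫ • a = ⟪a, n⟫ • n := (sub_eq_zero.1 hw0).symm
  have hb' : ⟪a, n⟫ ≠ 0 := fun h' => by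
    rw [h', zero_smul] at hna
    exact (smul_ne_zero hnn.ne' ha) hna
  refine ⟨⟪a, n⟫⁻¹ * ⟪n, n⟫, by positivity, ?_⟩
  rw [mul_smul, hna, smul_smul, inv_mul_cancel₀ hb', one_smul]

theorem eq_zero_of_mem_frontier {Ω U : Set (EuclideanSpace ℝ (Fin N))} (hΩ : IsOpen Ω)
    (hU : IsOpen U) {r : EuclideanSpace ℝ (Fin N) → ℝ} (hr : ContinuousOn r U)
    (hrΩ : ∀ x ∈ U, (x ∈ Ω ↔ 0 < r x)) {q : EuclideanSpace ℝ (Fin N)} (hq : q ∈ frontier Ω)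
    (hqU : q ∈ U) : r q = 0 := by
  refine le_antisymm ?_ ?_
  · refine not_lt.1 fun h => ?_
    have : q ∈ Ω ∩ frontier Ω := ⟨(hrΩ q hqU).2 h, hq⟩
    simp [hΩ.inter_frontier_eq] at this
  · refine not_lt.1 fun h => ?_
    have h1 : ∀ᶠ y in 𝓝 q, y ∈ U ∧ r y < 0 :=
      (hU.eventually_mem hqU).and ((hr.continuousAt (hU.mem_nhds hqU)).eventually_lt_const h)
    obtain ⟨y, hy, hyΩ⟩ := (mem_closure_iff_nhds.1 (frontier_subset_closure hq)) _ h1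
    exact absurd ((hrΩ y hy.1).1 hyΩ) (not_lt.2 hy.2.le)

/-- The segment from a point of `Ω` to a nearest boundary point is normal to the boundary. -/
theorem exists_sub_nearest_eq_smul_gradient {Ω U : Set (EuclideanSpace ℝ (Fin N))}
    (hΩ : IsOpen Ω) (hU : IsOpen U) {r : EuclideanSpace ℝ (Fin N) → ℝ}
    (hr : DifferentiableOn ℝ r U) (hrΩ : ∀ x ∈ U, (x ∈ Ω ↔ 0 < r x))
    {x q : EuclideanSpace ℝ (Fin N)} (hx : x ∈ Ω) (hq : q ∈ frontier Ω) (hqU : q ∈ U)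
    (hball : Metric.ball x (dist x q) ⊆ Ω) (hg : ∇ r q ≠ 0) :
    ∃ l : ℝ, 0 ≤ l ∧ x - q = l • ∇ r q := by
  have hrq := eq_zero_of_mem_frontier hΩ hU hr.continuousOn hrΩ hq hqU
  have hxq : x - q ≠ 0 := sub_ne_zero.2 fun h => by
    have : x ∈ Ω ∩ frontier Ω := ⟨hx, h ▸ hq⟩
    simp [hΩ.inter_frontier_eq] at this
  refine exists_eq_smul_of_halfspace hxq hg fun w hw => ?_
  have hd : HasDerivAt (fun t : ℝ => r (q + t • w)) ⟪∇ r q, w⟫ 0 := by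
    have h1 : HasFDerivAt r (fderiv ℝ r q) (q + (0 : ℝ) • w) := by
      simpa using (hr.differentiableAt (hU.mem_nhds hqU)).hasFDerivAt
    have h2 : HasDerivAt (fun t : ℝ => q + t • w) w 0 := by
      simpa using ((hasDerivAt_id (0 : ℝ)).smul_const w).const_add q
    rw [inner_gradient_left]
    exact h1.comp_hasDerivAt (0 : ℝ) h2
  refine ge_of_tendsto hd.tendsto_slope_zero_right ?_
  have hcont : Tendsto (fun t : ℝ => q + t • w) (𝓝[>] 0) (𝓝 q) := by
    have : Tendsto (fun t : ℝ => q + t • w) (𝓝 0) (𝓝 (q + (0 : ℝ) • w)) :=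
      Continuous.tendsto (by fun_prop) 0
    simpa using this.mono_left nhdsWithin_le_nhds
  have hsmall : ∀ᶠ t : ℝ in 𝓝[>] 0, t * ‖w‖ ^ 2 < 2 * ⟪x - q, w⟫ := by
    have : Tendsto (fun t : ℝ => t * ‖w‖ ^ 2) (𝓝 0) (𝓝 (0 * ‖w‖ ^ 2)) :=
      Continuous.tendsto (by fun_prop) 0
    rw [zero_mul] at this
    exact (this.mono_left nhdsWithin_le_nhds).eventually_lt_const (by linarith)
  filter_upwards [hcont.eventually (hU.mem_nhds hqU), hsmall, self_mem_nhdsWithin]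
    with t htU hts ht
  have ht0 : 0 < t := ht
  have hmem : q + t • w ∈ Ω := by
    refine hball ?_
    rw [Metric.mem_ball, dist_comm, dist_eq_norm, dist_eq_norm]
    refine lt_of_pow_lt_pow_left₀ 2 (norm_nonneg _) ?_
    have : x - (q + t • w) = (x - q) - t • w := by abel
    rw [this, norm_sub_sq_real, inner_smul_right, norm_smul, mul_pow, Real.norm_eq_abs, sq_abs]
    nlinarith
  have := (hrΩ _ htU).1 hmem
  simp only [zero_add, zero_smul, add_zero, hrq, sub_zero, smul_eq_mul]
  positivity

theorem contDiffAt_gradient {E : Type*} [NormedAddCommGroup E] [InnerProductSpace ℝ E]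
    [CompleteSpace E] {f : E → ℝ} {x : E} (hf : ContDiffAt ℝ ∞ f x) :
    ContDiffAt ℝ ∞ (∇ f) x :=
  (InnerProductSpace.toDual ℝ E).symm.toContinuousLinearEquiv.contDiff.contDiffAt.comp x
    (hf.fderiv_right (m := ∞) (by simp))

/-- The normal map `(q, l) ↦ (q + l ∇r(q), r(q))` is a local diffeomorphism at `(p, 0)`; its
inverse recovers the foot point and the height of a point near `p`. -/
theorem exists_smooth_inverse_normalMap {U : Set (EuclideanSpace ℝ (Fin N))} (hU : IsOpen U)
    {r : EuclideanSpace ℝ (Fin N) → ℝ} (hr : ContDiffOn ℝ ∞ r U)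
    {p : EuclideanSpace ℝ (Fin N)} (hp : p ∈ U) (hg : ∇ r p ≠ 0) :
    ∃ e : OpenPartialHomeomorph (EuclideanSpace ℝ (Fin N) × ℝ) (EuclideanSpace ℝ (Fin N) × ℝ),
      (∀ z, e z = (z.1 + z.2 • ∇ r z.1, r z.1)) ∧ (p, 0) ∈ e.source ∧
        ∃ V, IsOpen V ∧ V ⊆ e.target ∧ (p, r p) ∈ V ∧ ContDiffOn ℝ ∞ e.symm V := by
  set Φ : EuclideanSpace ℝ (Fin N) × ℝ → EuclideanSpace ℝ (Fin N) × ℝ :=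
    fun z => (z.1 + z.2 • ∇ r z.1, r z.1) with hΦ
  have hrA : ∀ q ∈ U, ContDiffAt ℝ ∞ r q := fun q hq => hr.contDiffAt (hU.mem_nhds hq)
  have hΦA : ∀ z : EuclideanSpace ℝ (Fin N) × ℝ, z.1 ∈ U → ContDiffAt ℝ ∞ Φ z := by
    intro z hz
    have h1 : ContDiffAt ℝ ∞ (fun z : EuclideanSpace ℝ (Fin N) × ℝ => ∇ r z.1) z :=
      (contDiffAt_gradient (hrA _ hz)).comp z contDiffAt_fst
    have h2 : ContDiffAt ℝ ∞ (fun z : EuclideanSpace ℝ (Fin N) × ℝ => r z.1) z :=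
      (hrA _ hz).comp z contDiffAt_fst
    exact (contDiffAt_fst.add (contDiffAt_snd.smul h1)).prodMk h2
  have hinj : Function.Injective (fderiv ℝ Φ (p, 0)) := by
    have hd1 : DifferentiableAt ℝ (∇ r) p :=
      (contDiffAt_gradient (hrA p hp)).differentiableAt (by simp)
    have hd2 : DifferentiableAt ℝ r p := (hrA p hp).differentiableAt (by simp)
    have hf : HasFDerivAt (fun z : EuclideanSpace ℝ (Fin N) × ℝ => z.1)
      (ContinuousLinearMap.fst ℝ _ ℝ) (p, 0) := hasFDerivAt_fst
    have hs : HasFDerivAt (fun z : EuclideanSpace ℝ (Fin N) × ℝ => z.2)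
      (ContinuousLinearMap.snd ℝ _ ℝ) (p, 0) := hasFDerivAt_snd
    have h1 : HasFDerivAt (fun z : EuclideanSpace ℝ (Fin N) × ℝ => ∇ r z.1) _ (p, 0) :=
      HasFDerivAt.comp (g := ∇ r) (p, (0 : ℝ)) hd1.hasFDerivAt hf
    have h2 : HasFDerivAt (fun z : EuclideanSpace ℝ (Fin N) × ℝ => r z.1) _ (p, 0) :=
      HasFDerivAt.comp (g := r) (p, (0 : ℝ)) hd2.hasFDerivAt hf
    have h3 : HasFDerivAt Φ _ (p, 0) := (hf.add (hs.smul h1)).prodMk h2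
    rw [h3.fderiv]
    refine (injective_iff_map_eq_zero _).2 ?_
    rintro ⟨a, t⟩ hat
    simp only [ContinuousLinearMap.prod_apply, Prod.mk_eq_zero, add_apply,
      ContinuousLinearMap.coe_fst', zero_smul, ContinuousLinearMap.smulRight_apply,
      ContinuousLinearMap.coe_snd', ContinuousLinearMap.comp_apply, zero_add] at hat
    obtain ⟨ha, hb⟩ := hat
    have ha' : a = -(t • ∇ r p) := eq_neg_of_add_eq_zero_left ha
    rw [← inner_gradient_left, ha', inner_neg_right, inner_smul_right, neg_eq_zero,
      mul_eq_zero] at hb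
    have ht : t = 0 := hb.resolve_right (real_inner_self_pos.2 hg).ne'
    subst ht
    simpa using ha'
  let L : (EuclideanSpace ℝ (Fin N) × ℝ) ≃L[ℝ] (EuclideanSpace ℝ (Fin N) × ℝ) :=
    (LinearEquiv.ofInjectiveEndo (fderiv ℝ Φ (p, 0)).toLinearMap hinj).toContinuousLinearEquiv
  have hL : HasFDerivAt Φ (L : _ →L[ℝ] _) (p, 0) := by
    have : (L : (EuclideanSpace ℝ (Fin N) × ℝ) →L[ℝ] _) = fderiv ℝ Φ (p, 0) := by
      exact ContinuousLinearMap.ext fun z => rfl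
    rw [this]
    exact ((hΦA (p, 0) hp).differentiableAt (by simp)).hasFDerivAt
  set e := (hΦA (p, 0) hp).toOpenPartialHomeomorph Φ hL (by simp) with he
  have heΦ : ∀ z, e z = Φ z := fun z => rfl
  have hps : (p, (0 : ℝ)) ∈ e.source :=
    ContDiffAt.mem_toOpenPartialHomeomorph_source (hΦA (p, 0) hp) hL (by simp)
  have hep : e (p, 0) = (p, r p) := by rw [heΦ]; simp [hΦ]
  have hpt : (p, r p) ∈ e.target := hep ▸ e.map_source hps
  have hsp : e.symm (p, r p) = (p, 0) := by rw [← hep, e.left_inv hps]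
  -- near `(p, 0)` the derivative of the normal map stays invertible
  have hev : ∀ᶠ z in 𝓝 (p, (0 : ℝ)), z.1 ∈ U ∧ fderiv ℝ Φ z ∈
      range ((↑) : ((EuclideanSpace ℝ (Fin N) × ℝ) ≃L[ℝ] (EuclideanSpace ℝ (Fin N) × ℝ)) →
        (EuclideanSpace ℝ (Fin N) × ℝ) →L[ℝ] (EuclideanSpace ℝ (Fin N) × ℝ)) := by
    refine (continuousAt_fst.eventually (hU.mem_nhds hp)).and ?_
    have hc : ContinuousAt (fderiv ℝ Φ) (p, 0) :=
      ((hΦA (p, 0) hp).fderiv_right (m := 0) (by simp)).continuousAt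
    exact hc.eventually (ContinuousLinearEquiv.isOpen.mem_nhds ⟨L, hL.fderiv.symm⟩)
  have hev' : ∀ᶠ y in 𝓝 (p, r p), y ∈ e.target ∧ (e.symm y).1 ∈ U ∧ fderiv ℝ Φ (e.symm y) ∈
      range ((↑) : ((EuclideanSpace ℝ (Fin N) × ℝ) ≃L[ℝ] (EuclideanSpace ℝ (Fin N) × ℝ)) →
        (EuclideanSpace ℝ (Fin N) × ℝ) →L[ℝ] (EuclideanSpace ℝ (Fin N) × ℝ)) := by
    refine (e.open_target.eventually_mem hpt).and ?_
    have hc := e.continuousAt_symm hpt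
    rw [ContinuousAt, hsp] at hc
    exact hc.eventually hev
  obtain ⟨V, hVsub, hVo, hpV⟩ := eventually_nhds_iff.1 hev'
  refine ⟨e, heΦ, hps, V, hVo, fun y hy => (hVsub y hy).1, hpV, fun y hy => ?_⟩
  obtain ⟨hyt, hyU, L', hL'⟩ := hVsub y hy
  refine (e.contDiffAt_symm (f₀' := L') hyt ?_ (hΦA _ hyU)).contDiffWithinAt
  rw [hL']
  exact ((hΦA _ hyU).differentiableAt (by simp)).hasFDerivAt

/-- Near each boundary point the distance is, inside `Ω`, the restriction of a function that is
smooth across the boundary. -/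
theorem IsBoundedSmoothDomain.exists_smooth_extension_bdryDist (hN : 2 ≤ N)
    {Ω : Set (EuclideanSpace ℝ (Fin N))} (hΩ : IsBoundedSmoothDomain Ω)
    {p : EuclideanSpace ℝ (Fin N)} (hp : p ∈ frontier Ω) :
    ∃ W, IsOpen W ∧ p ∈ W ∧ ∃ f : EuclideanSpace ℝ (Fin N) → ℝ, ContDiffOn ℝ ∞ f W ∧
      ∀ x ∈ W, x ∈ Ω → bdryDist Ω x = f x := by
  obtain ⟨U, hU, hpU, r, hr, hdr, hrΩ⟩ := hΩ.smooth_boundary p hp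
  have hgp : ∇ r p ≠ 0 := fun h => hdr (by
    ext w; rw [← inner_gradient_left, h, inner_zero_left]; rfl)
  have hrc := hr.continuousOn
  have hrp : r p = 0 := eq_zero_of_mem_frontier hΩ.isOpen hU hrc hrΩ hp hpU
  obtain ⟨e, he, hps, V, hV, hVt, hpV, heV⟩ := exists_smooth_inverse_normalMap hU hr hpU hgp
  rw [hrp] at hpV
  have hsp : e.symm (p, 0) = (p, 0) := by
    have := e.left_inv hps
    rwa [he, hrp, zero_smul, add_zero] at this
  have hgc : ContinuousAt (∇ r) p :=
    (contDiffAt_gradient (hr.contDiffAt (hU.mem_nhds hpU))).continuousAt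
  -- near `p` the gradient of `r` is bounded below by `c`
  set c := ‖∇ r p‖ / 2 with hc
  have hc0 : 0 < c := by positivity
  have hnear : ∀ᶠ q in 𝓝 p, q ∈ U ∧ c < ‖∇ r q‖ :=
    (hU.eventually_mem hpU).and (hgc.norm.eventually_const_lt (by
      have := norm_pos_iff.2 hgp; rw [hc]; linarith))
  have hsrc := e.open_source.mem_nhds hps
  rw [nhds_prod_eq] at hsrc
  obtain ⟨A, hA, B, hB, hAB⟩ := mem_prod_iff.1 hsrc
  obtain ⟨ε, hε, hεB⟩ := Metric.mem_nhds_iff.1 hB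
  obtain ⟨η, hη, hηA⟩ := Metric.mem_nhds_iff.1 (inter_mem hA hnear)
  -- the smooth extension is the height times the length of the gradient at the foot point
  have hsymm : ∀ᶠ y in 𝓝 (p, (0 : ℝ)), y ∈ V ∧ (e.symm y).1 ∈ U ∧ ∇ r (e.symm y).1 ≠ 0 := by
    refine (hV.eventually_mem hpV).and ?_
    have hc1 : ContinuousAt (fun y => (e.symm y).1) (p, (0 : ℝ)) :=
      (heV.continuousOn.continuousAt (hV.mem_nhds hpV)).fst
    rw [ContinuousAt, hsp] at hc1
    filter_upwards [hc1.eventually hnear] with y hy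
    exact ⟨hy.1, norm_pos_iff.1 (hc0.trans hy.2)⟩
  obtain ⟨V', hV'sub, hV'o, hpV'⟩ := eventually_nhds_iff.1 hsymm
  set d := min (η / 2) (ε * c) with hd
  have hd0 : 0 < d := by positivity
  refine ⟨Metric.ball p d ∩ (fun x => (x, (0 : ℝ))) ⁻¹' V',
    Metric.isOpen_ball.inter (hV'o.preimage (by fun_prop)), ⟨Metric.mem_ball_self hd0, hpV'⟩,
    fun x => (e.symm (x, 0)).2 * ‖∇ r (e.symm (x, 0)).1‖, ?_, ?_⟩
  · rintro x ⟨-, hx⟩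
    obtain ⟨hxV, hxU, hxg⟩ := hV'sub _ hx
    have h1 : ContDiffAt ℝ ∞ (fun x => e.symm (x, (0 : ℝ))) x :=
      ContDiffAt.comp (g := e.symm) x (heV.contDiffAt (hV.mem_nhds hxV))
        (contDiffAt_id.prodMk contDiffAt_const)
    have h2 : ContDiffAt ℝ ∞ (fun x => ∇ r (e.symm (x, (0 : ℝ))).1) x :=
      ContDiffAt.comp (g := ∇ r) x (contDiffAt_gradient (hr.contDiffAt (hU.mem_nhds hxU))) h1.fst
    exact (h1.snd.mul (h2.norm ℝ hxg)).contDiffWithinAt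
  · rintro x ⟨hxd, hxV'⟩ hxΩ
    obtain ⟨q, hq, hδ⟩ := hΩ.exists_nearest hN x
    have hxp : dist x p < d := hxd
    have hxq : dist x q ≤ dist x p := hδ ▸ Metric.infDist_le_dist_of_mem hp
    have hqp : dist q p < η := by
      have h1 := dist_triangle q x p
      rw [dist_comm q x] at h1
      have h2 : d ≤ η / 2 := min_le_left _ _
      linarith
    obtain ⟨hqA, hqU, hqc⟩ := hηA hqp
    obtain ⟨l, hl, hxql⟩ := exists_sub_nearest_eq_smul_gradient hΩ.isOpen hU
      (hr.differentiableOn (by simp)) hrΩ hxΩ hq hqU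
      (hδ ▸ hΩ.ball_bdryDist_subset hxΩ) (norm_pos_iff.1 (hc0.trans hqc))
    have hdist : dist x q = l * ‖∇ r q‖ := by
      rw [dist_eq_norm, hxql, norm_smul, Real.norm_of_nonneg hl]
    have hlε : l < ε := by
      have h2 : d ≤ ε * c := min_le_right _ _
      have h3 : l * c ≤ l * ‖∇ r q‖ := mul_le_mul_of_nonneg_left hqc.le hl
      exact lt_of_mul_lt_mul_right (by linarith) hc0.le
    have hmem : (q, l) ∈ e.source := hAB ⟨hqA, hεB (by
      rw [Metric.mem_ball, Real.dist_eq, sub_zero, abs_of_nonneg hl]; exact hlε)⟩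
    have heq : e (q, l) = (x, 0) := by
      rw [he, eq_zero_of_mem_frontier hΩ.isOpen hU hrc hrΩ hq hqU, ← hxql]
      simp
    have hinv : e.symm (x, 0) = (q, l) := by rw [← heq, e.left_inv hmem]
    simp only [hinv]
    rw [hδ, hdist]

theorem laplacian_eq_sum_fderiv {f : EuclideanSpace ℝ (Fin N) → ℝ}
    {x : EuclideanSpace ℝ (Fin N)} (hf : ContDiffAt ℝ 2 f x) :
    Δ f x = ∑ i, fderiv ℝ (fun y => fderiv ℝ f y (EuclideanSpace.single i 1)) x
      (EuclideanSpace.single i 1) := by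
  rw [InnerProductSpace.laplacian_eq_iteratedFDeriv_orthonormalBasis f
    (EuclideanSpace.basisFun (Fin N) ℝ)]
  refine Finset.sum_congr rfl fun i _ => ?_
  have hd : DifferentiableAt ℝ (fderiv ℝ f) x :=
    (hf.fderiv_right (m := 1) (by norm_num)).differentiableAt (by simp)
  rw [iteratedFDeriv_two_apply, fderiv_clm_apply hd (differentiableAt_const _)]
  simp

theorem contDiffAt_fderiv_apply {E : Type*} [NormedAddCommGroup E] [NormedSpace ℝ E] {f : E → ℝ}
    {x : E} (hf : ContDiffAt ℝ ∞ f x) (v : E) : ContDiffAt ℝ ∞ (fun y => fderiv ℝ f y v) x :=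
  (hf.fderiv_right (m := ∞) (by simp)).clm_apply contDiffAt_const

theorem continuousOn_laplacian {f : EuclideanSpace ℝ (Fin N) → ℝ}
    {W : Set (EuclideanSpace ℝ (Fin N))} (hW : IsOpen W) (hf : ContDiffOn ℝ ∞ f W) :
    ContinuousOn (Δ f) W := by
  have hA : ∀ x ∈ W, ContDiffAt ℝ ∞ f x := fun x hx => hf.contDiffAt (hW.mem_nhds hx)
  refine ContinuousOn.congr (f := fun x => ∑ i, fderiv ℝ
    (fun y => fderiv ℝ f y (EuclideanSpace.single i 1)) x (EuclideanSpace.single i 1)) ?_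
    fun x hx => laplacian_eq_sum_fderiv ((hA x hx).of_le (WithTop.coe_le_coe.2 le_top))
  refine continuousOn_finsetSum _ fun i _ x hx => ?_
  exact (contDiffAt_fderiv_apply (contDiffAt_fderiv_apply (hA x hx) _)
    _).continuousAt.continuousWithinAt

/-- In some strip the distance to the boundary is smooth, satisfies the eikonal equation and has
bounded Laplacian. -/
theorem IsBoundedSmoothDomain.exists_strip_smooth (hN : 2 ≤ N)
    {Ω : Set (EuclideanSpace ℝ (Fin N))} (hΩ : IsBoundedSmoothDomain Ω) :
    ∃ ρ > 0, ∃ M : ℝ, 0 ≤ M ∧ ∀ x ∈ bdryStrip Ω ρ, ContDiffAt ℝ ∞ (bdryDist Ω) x ∧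
      ‖∇ (bdryDist Ω) x‖ = 1 ∧ |Δ (bdryDist Ω) x| ≤ M := by
  have key : ∃ M : ℝ, ∀ᶠ x in 𝓝ˢ (frontier Ω), x ∈ Ω → ContDiffAt ℝ ∞ (bdryDist Ω) x ∧
      |Δ (bdryDist Ω) x| ≤ M := by
    refine hΩ.isCompact_frontier.induction_on (p := fun s => ∃ M : ℝ, ∀ᶠ x in 𝓝ˢ s, x ∈ Ω →
      ContDiffAt ℝ ∞ (bdryDist Ω) x ∧ |Δ (bdryDist Ω) x| ≤ M) ⟨0, by simp⟩ ?_ ?_ ?_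
    · rintro s t hst ⟨M, hM⟩
      exact ⟨M, hM.filter_mono (nhdsSet_mono hst)⟩
    · rintro s t ⟨M, hM⟩ ⟨M', hM'⟩
      refine ⟨max M M', ?_⟩
      rw [nhdsSet_union, eventually_sup]
      exact ⟨hM.mono fun x hx hΩ => ⟨(hx hΩ).1, (hx hΩ).2.trans (le_max_left _ _)⟩,
        hM'.mono fun x hx hΩ => ⟨(hx hΩ).1, (hx hΩ).2.trans (le_max_right _ _)⟩⟩
    · intro p hp
      obtain ⟨W, hW, hpW, f, hf, hfΩ⟩ := hΩ.exists_smooth_extension_bdryDist hN hp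
      have hc : ContinuousAt (Δ f) p :=
        (continuousOn_laplacian hW hf).continuousAt (hW.mem_nhds hpW)
      have hev : ∀ᶠ x in 𝓝 p, x ∈ W ∧ |Δ f x| < |Δ f p| + 1 :=
        (hW.eventually_mem hpW).and (hc.abs.eventually_lt_const (by linarith))
      obtain ⟨W', hW'sub, hW'o, hpW'⟩ := eventually_nhds_iff.1 hev
      refine ⟨W', mem_nhdsWithin_of_mem_nhds (hW'o.mem_nhds hpW'), |Δ f p| + 1, ?_⟩
      filter_upwards [hW'o.mem_nhdsSet_self] with x hx hxΩ
      have heq : bdryDist Ω =ᶠ[𝓝 x] f := by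
        filter_upwards [hW.mem_nhds (hW'sub x hx).1, hΩ.isOpen.mem_nhds hxΩ] with y hy hyΩ
        exact hfΩ y hy hyΩ
      refine ⟨(hf.contDiffAt (hW.mem_nhds (hW'sub x hx).1)).congr_of_eventuallyEq heq, ?_⟩
      rw [(InnerProductSpace.laplacian_congr_nhds heq).eq_of_nhds]
      exact (hW'sub x hx).2.le
  obtain ⟨M, hM⟩ := key
  obtain ⟨ρ, hρ, hsub⟩ := (Metric.hasBasis_nhdsSet_thickening hΩ.isCompact_frontier).mem_iff.1 hM
  refine ⟨ρ, hρ, max M 0, le_max_right _ _, fun x hx => ?_⟩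
  obtain ⟨q, hq, hδ⟩ := hΩ.exists_nearest hN x
  have hxt : x ∈ Metric.thickening ρ (frontier Ω) :=
    Metric.mem_thickening_iff.2 ⟨q, hq, hδ ▸ hx.2⟩
  obtain ⟨hC, hL⟩ := hsub hxt hx.1
  refine ⟨hC, ?_, hL.trans (le_max_left _ _)⟩
  have hdiff : DifferentiableAt ℝ (bdryDist Ω) x := hC.differentiableAt (by simp)
  refine le_antisymm ?_ ?_
  · have : ‖∇ (bdryDist Ω) x‖ = ‖fderiv ℝ (bdryDist Ω) x‖ :=
      (InnerProductSpace.toDual ℝ _).symm.norm_map _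
    rw [this]
    exact norm_fderiv_le_of_lipschitz ℝ (Metric.lipschitz_infDist_pt (frontier Ω)) (x₀ := x)
  · -- the distance decreases at unit speed towards the nearest boundary point
    have hpos := hΩ.bdryDist_pos hN hx.1
    have hd : HasDerivAt (fun t : ℝ => bdryDist Ω (x + t • (q - x)))
        ⟪∇ (bdryDist Ω) x, q - x⟫ 0 := by
      have h1 : HasFDerivAt (bdryDist Ω) (fderiv ℝ (bdryDist Ω) x) (x + (0 : ℝ) • (q - x)) := by
        simpa using hdiff.hasFDerivAt
      have h2 : HasDerivAt (fun t : ℝ => x + t • (q - x)) (q - x) 0 := by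
        simpa using ((hasDerivAt_id (0 : ℝ)).smul_const (q - x)).const_add x
      rw [inner_gradient_left]
      exact h1.comp_hasDerivAt (0 : ℝ) h2
    have hle : ⟪∇ (bdryDist Ω) x, q - x⟫ ≤ -bdryDist Ω x := by
      refine le_of_tendsto hd.tendsto_slope_zero_right ?_
      filter_upwards [Ioo_mem_nhdsGT (zero_lt_one' ℝ)] with t ht
      have h3 : bdryDist Ω (x + t • (q - x)) ≤ (1 - t) * bdryDist Ω x := by
        refine (Metric.infDist_le_dist_of_mem hq).trans_eq ?_
        rw [hδ, dist_eq_norm, dist_eq_norm,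
          show x + t • (q - x) - q = (1 - t) • (x - q) by module, norm_smul,
          Real.norm_of_nonneg (by linarith [ht.2])]
      simp only [zero_add, zero_smul, add_zero, smul_eq_mul]
      have ht0 : 0 < t := ht.1
      rw [inv_mul_le_iff₀ ht0]
      linarith
    have hcs := abs_real_inner_le_norm (∇ (bdryDist Ω) x) (q - x)
    have hqx : ‖q - x‖ = bdryDist Ω x := by rw [hδ, dist_eq_norm, norm_sub_rev]
    rw [hqx] at hcs
    have h4 := (neg_le_abs _).trans hcs
    exact le_of_mul_le_mul_right (by linarith) hpos

/-! ### Calculus of weak gradients -/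

section Auxiliary

variable {X : Type*} [TopologicalSpace X] [T2Space X] [MeasurableSpace X] [BorelSpace X]
  {F F' : Type*} [NormedAddCommGroup F] [NormedAddCommGroup F']
  {m : Measure X}

theorem memLp_of_norm_le_continuousOn_mul {K : Set X} (hK : IsCompact K) {p : ENNReal} {f : X → F}
    (hf : MemLp f p (m.restrict K)) {w : X → ℝ} (hw : ContinuousOn w K) {g : X → F'}
    (hg : AEStronglyMeasurable g (m.restrict K)) (hle : ∀ x ∈ K, ‖g x‖ ≤ |w x| * ‖f x‖) :
    MemLp g p (m.restrict K) := by
  obtain ⟨C, hC⟩ := hK.exists_bound_of_continuousOn hw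
  refine hf.of_le_mul hg (c := C) ?_
  filter_upwards [ae_restrict_mem hK.measurableSet] with x hx
  exact (hle x hx).trans (mul_le_mul_of_nonneg_right (hC x hx) (norm_nonneg _))

theorem memLp_of_continuousOn_isCompact [IsFiniteMeasureOnCompacts m] {K : Set X}
    (hK : IsCompact K) (p : ENNReal) {w : X → F} (hw : ContinuousOn w K) :
    MemLp w p (m.restrict K) := by
  have : IsFiniteMeasure (m.restrict K) := ⟨by simpa using hK.measure_lt_top⟩
  obtain ⟨C, hC⟩ := hK.exists_bound_of_continuousOn hw
  refine MemLp.of_bound (hw.aestronglyMeasurable_of_isCompact hK hK.measurableSet) C ?_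
  filter_upwards [ae_restrict_mem hK.measurableSet] with x hx using hC x hx

variable [NormedSpace ℝ F]

theorem memLp_continuousOn_smul {K : Set X} (hK : IsCompact K) {p : ENNReal} {f : X → F}
    (hf : MemLp f p (m.restrict K)) {w : X → ℝ} (hw : ContinuousOn w K) :
    MemLp (fun x => w x • f x) p (m.restrict K) :=
  memLp_of_norm_le_continuousOn_mul hK hf hw
    ((hw.aestronglyMeasurable hK.measurableSet).smul hf.1) fun x _ => by rw [norm_smul]; rfl

theorem memLp_smul_continuousOn {K : Set X} (hK : IsCompact K) {p : ENNReal} {f : X → ℝ}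
    (hf : MemLp f p (m.restrict K)) {w : X → F} (hw : ContinuousOn w K) :
    MemLp (fun x => f x • w x) p (m.restrict K) :=
  memLp_of_norm_le_continuousOn_mul hK hf hw.norm
    (hf.1.smul (hw.aestronglyMeasurable_of_isCompact hK hK.measurableSet)) fun x _ => by
      rw [norm_smul, abs_norm, mul_comm]

/-- A locally integrable function on `G` times a continuous function with compact support in `G`
is integrable over the whole space. -/
theorem integrable_smul_of_tsupport_subset {G : Set X} {f : X → F}
    (hf : ∀ K ⊆ G, IsCompact K → IntegrableOn f K m) {w : X → ℝ} (hw : Continuous w)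
    (hwc : HasCompactSupport w) (hwG : tsupport w ⊆ G) : Integrable (fun x => w x • f x) m := by
  refine (integrableOn_iff_integrable_of_support_subset (s := tsupport w) ?_).1
    ((hf _ hwG hwc).continuousOn_smul hw.continuousOn hwc)
  intro x hx
  by_contra h
  exact hx (by simp [image_eq_zero_of_notMem_tsupport h])

end Auxiliary

theorem integrable_inner_of_memLp {X F : Type*} [MeasurableSpace X] [NormedAddCommGroup F]
    [InnerProductSpace ℝ F] {m : Measure X} {f g : X → F} (hf : MemLp f 2 m) (hg : MemLp g 2 m) :
    Integrable (fun x => ⟪f x, g x⟫) m :=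
  (hf.norm.integrable_mul hg.norm).mono' (hf.1.inner hg.1)
    (Eventually.of_forall fun x => norm_inner_le_norm (f x) (g x))

theorem contDiff_mul_of_tsupport_subset {E : Type*} [NormedAddCommGroup E] [NormedSpace ℝ E]
    {G : Set E} (hG : IsOpen G) {η a : E → ℝ} (hη : ContDiff ℝ ∞ η) (hηG : tsupport η ⊆ G)
    (ha : ContDiffOn ℝ ∞ a G) : ContDiff ℝ ∞ (fun x => η x * a x) := by
  refine contDiff_iff_contDiffAt.2 fun x => ?_
  by_cases hx : x ∈ tsupport η
  · exact hη.contDiffAt.mul (ha.contDiffAt (hG.mem_nhds (hηG hx)))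
  · refine (contDiffAt_const (c := (0 : ℝ))).congr_of_eventuallyEq ?_
    filter_upwards [notMem_tsupport_iff_eventuallyEq.1 hx] with y hy
    simp [hy]

theorem exists_cutoff {E : Type*} [NormedAddCommGroup E] [NormedSpace ℝ E]
    [FiniteDimensional ℝ E] {G K : Set E} (hG : IsOpen G) (hK : IsCompact K) (hKG : K ⊆ G) :
    ∃ χ : E → ℝ, ContDiff ℝ ∞ χ ∧ HasCompactSupport χ ∧ tsupport χ ⊆ G ∧
      ∀ x ∈ K, χ =ᶠ[𝓝 x] 1 := by
  obtain ⟨L, hL, hKL, hLG⟩ := exists_compact_between hK hG hKG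
  obtain ⟨f, hf1, hf0, -⟩ := exists_contMDiffMap_one_nhds_of_subset_interior
    (modelWithCornersSelf ℝ E) (n := ⊤) hK.isClosed hKL
  have hsub : tsupport f ⊆ L := closure_minimal
    (fun x hx => by_contra fun h => hx (hf0 x h)) hL.isClosed
  refine ⟨f, f.contMDiff.contDiff, hL.of_isClosed_subset (isClosed_tsupport _) hsub,
    hsub.trans hLG, fun x hx => ?_⟩
  exact eventually_nhdsSet_iff_forall.1 hf1 x hx

section WeakGradient

variable {G : Set (EuclideanSpace ℝ (Fin N))} {u w : EuclideanSpace ℝ (Fin N) → ℝ}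
  {g k : EuclideanSpace ℝ (Fin N) → EuclideanSpace ℝ (Fin N)}

/-- A test function `η` smooth with compact support in `G`. -/
structure IsTest (G : Set (EuclideanSpace ℝ (Fin N))) (η : EuclideanSpace ℝ (Fin N) → ℝ) :
    Prop where
  contDiff : ContDiff ℝ ∞ η
  hasCompactSupport : HasCompactSupport η
  tsupport_subset : tsupport η ⊆ G

namespace IsTest

variable {η : EuclideanSpace ℝ (Fin N) → ℝ}

theorem mul_contDiffOn (hη : IsTest G η) (hG : IsOpen G)
    {a : EuclideanSpace ℝ (Fin N) → ℝ} (ha : ContDiffOn ℝ ∞ a G) :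
    IsTest G (fun x => η x * a x) :=
  ⟨contDiff_mul_of_tsupport_subset hG hη.contDiff hη.tsupport_subset ha,
    hη.hasCompactSupport.mul_right, (tsupport_mul_subset_left).trans hη.tsupport_subset⟩

theorem fderiv_apply (hη : IsTest G η) (v : EuclideanSpace ℝ (Fin N)) :
    IsTest G (fun x => fderiv ℝ η x v) := by
  have hsub : tsupport (fun x => fderiv ℝ η x v) ⊆ tsupport η :=
    tsupport_fderiv_apply_subset ℝ v
  exact ⟨contDiff_iff_contDiffAt.2 fun x => contDiffAt_fderiv_apply hη.contDiff.contDiffAt v,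
    hη.hasCompactSupport.of_isClosed_subset (isClosed_tsupport _) hsub,
    hsub.trans hη.tsupport_subset⟩

theorem integrable_smul {F : Type*} [NormedAddCommGroup F] [NormedSpace ℝ F] (hη : IsTest G η)
    {f : EuclideanSpace ℝ (Fin N) → F} (hf : ∀ K ⊆ G, IsCompact K → IntegrableOn f K) :
    Integrable (fun x => η x • f x) :=
  integrable_smul_of_tsupport_subset hf hη.contDiff.continuous hη.hasCompactSupport
    hη.tsupport_subset

end IsTest

theorem locallyIntegrableOn_of_memLp {F : Type*} [NormedAddCommGroup F] (hG : IsOpen G)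
    {f : EuclideanSpace ℝ (Fin N) → F}
    (hf : ∀ K ⊆ G, IsCompact K → MemLp f 2 (volume.restrict K)) :
    LocallyIntegrableOn f G volume := by
  refine (locallyIntegrableOn_iff hG.isLocallyClosed).2 fun K hKG hK => ?_
  have : IsFiniteMeasure ((volume : Measure (EuclideanSpace ℝ (Fin N))).restrict K) :=
    ⟨by simpa using hK.measure_lt_top⟩
  exact (hf K hKG hK).integrable (by norm_num)

namespace HasWeakGradientOn

theorem integrableOn (hG : IsOpen G) (hu : HasWeakGradientOn G u g)
    {K : Set (EuclideanSpace ℝ (Fin N))} (hKG : K ⊆ G) (hK : IsCompact K) : IntegrableOn u K :=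
  (locallyIntegrableOn_iff hG.isLocallyClosed).1 hu.locallyIntegrableOn K hKG hK

theorem integrableOn_gradient (hG : IsOpen G) (hu : HasWeakGradientOn G u g)
    {K : Set (EuclideanSpace ℝ (Fin N))} (hKG : K ⊆ G) (hK : IsCompact K) : IntegrableOn g K :=
  (locallyIntegrableOn_iff hG.isLocallyClosed).1 hu.locallyIntegrableOn_gradient K hKG hK

end HasWeakGradientOn

namespace MemH1Loc

theorem of_memLp (hG : IsOpen G) (hu : ∀ K ⊆ G, IsCompact K → MemLp u 2 (volume.restrict K))
    (hg : ∀ K ⊆ G, IsCompact K → MemLp g 2 (volume.restrict K))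
    (h : ∀ η, IsTest G η → ∀ v, ∫ x in G, u x * fderiv ℝ η x v = - ∫ x in G, ⟪g x, v⟫ * η x) :
    MemH1Loc G u g :=
  ⟨⟨locallyIntegrableOn_of_memLp hG hu, locallyIntegrableOn_of_memLp hG hg,
    fun η h1 h2 h3 => h η ⟨h1, h2, h3⟩⟩, hu, hg⟩

theorem integrable_test_mul (hG : IsOpen G) (hu : MemH1Loc G u g)
    {η : EuclideanSpace ℝ (Fin N) → ℝ} (hη : IsTest G η) : Integrable (fun x => u x * η x) := by
  simpa only [smul_eq_mul, mul_comm] using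
    hη.integrable_smul fun K => hu.hasWeakGradientOn.integrableOn hG

theorem integrable_test_mul_inner (hG : IsOpen G) (hu : MemH1Loc G u g)
    {η : EuclideanSpace ℝ (Fin N) → ℝ} (hη : IsTest G η) (v : EuclideanSpace ℝ (Fin N)) :
    Integrable (fun x => ⟪g x, v⟫ * η x) := by
  have := (hη.integrable_smul fun K =>
    hu.hasWeakGradientOn.integrableOn_gradient hG).inner_const (𝕜 := ℝ) v
  simpa only [real_inner_smul_left, mul_comm] using this

theorem add (hG : IsOpen G) (hu : MemH1Loc G u g) (hw : MemH1Loc G w k) :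
    MemH1Loc G (fun x => u x + w x) (fun x => g x + k x) := by
  refine of_memLp hG (fun K hKG hK => (hu.memLp K hKG hK).add (hw.memLp K hKG hK))
    (fun K hKG hK => (hu.memLp_gradient K hKG hK).add (hw.memLp_gradient K hKG hK))
    fun η hη v => ?_
  simp only [add_mul, inner_add_left]
  rw [integral_add (hu.integrable_test_mul hG (hη.fderiv_apply v)).integrableOn
      (hw.integrable_test_mul hG (hη.fderiv_apply v)).integrableOn,
    integral_add (hu.integrable_test_mul_inner hG hη v).integrableOn
      (hw.integrable_test_mul_inner hG hη v).integrableOn,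
    hu.hasWeakGradientOn.integral_eq η hη.1 hη.2 hη.3,
    hw.hasWeakGradientOn.integral_eq η hη.1 hη.2 hη.3, neg_add]

theorem const_mul (hG : IsOpen G) (hu : MemH1Loc G u g) (c : ℝ) :
    MemH1Loc G (fun x => c * u x) (fun x => c • g x) := by
  refine of_memLp hG (fun K hKG hK => (hu.memLp K hKG hK).const_mul c)
    (fun K hKG hK => (hu.memLp_gradient K hKG hK).const_smul c) fun η hη v => ?_
  simp only [mul_assoc, real_inner_smul_left, integral_const_mul]
  rw [hu.hasWeakGradientOn.integral_eq η hη.1 hη.2 hη.3, mul_neg]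

theorem mono {G' : Set (EuclideanSpace ℝ (Fin N))} (hG' : IsOpen G')
    (hsub : G' ⊆ G) (hu : MemH1Loc G u g) : MemH1Loc G' u g := by
  refine of_memLp hG' (fun K hKG hK => hu.memLp K (hKG.trans hsub) hK)
    (fun K hKG hK => hu.memLp_gradient K (hKG.trans hsub) hK) fun η hη v => ?_
  have h0 : ∀ x ∉ G', η x = 0 ∧ fderiv ℝ η x v = 0 := fun x hx =>
    ⟨image_eq_zero_of_notMem_tsupport fun h => hx (hη.tsupport_subset h),
      image_eq_zero_of_notMem_tsupport (f := fun x => fderiv ℝ η x v)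
        fun h => hx ((hη.fderiv_apply v).tsupport_subset h)⟩
  have h1 := hu.hasWeakGradientOn.integral_eq η hη.1 hη.2 (hη.3.trans hsub) v
  have h2 : ∀ x ∉ G, η x = 0 ∧ fderiv ℝ η x v = 0 := fun x hx => h0 x fun h => hx (hsub h)
  rw [setIntegral_eq_integral_of_forall_compl_eq_zero (fun x hx => by simp [(h2 x hx).2]),
    setIntegral_eq_integral_of_forall_compl_eq_zero (fun x hx => by simp [(h2 x hx).1])] at h1
  rw [setIntegral_eq_integral_of_forall_compl_eq_zero (fun x hx => by simp [(h0 x hx).2]),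
    setIntegral_eq_integral_of_forall_compl_eq_zero (fun x hx => by simp [(h0 x hx).1]), h1]

theorem smooth_mul (hG : IsOpen G) (hu : MemH1Loc G u g) {a : EuclideanSpace ℝ (Fin N) → ℝ}
    (ha : ContDiffOn ℝ ∞ a G) :
    MemH1Loc G (fun x => a x * u x) (fun x => a x • g x + u x • ∇ a x) := by
  have haA : ∀ x ∈ G, ContDiffAt ℝ ∞ a x := fun x hx => ha.contDiffAt (hG.mem_nhds hx)
  have hac : ContinuousOn a G := ha.continuousOn
  have hgc : ContinuousOn (∇ a) G := fun x hx =>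
    (contDiffAt_gradient (haA x hx)).continuousAt.continuousWithinAt
  refine of_memLp hG
    (fun K hKG hK => memLp_continuousOn_smul hK (hu.memLp K hKG hK) (hac.mono hKG))
    (fun K hKG hK =>
      (memLp_continuousOn_smul hK (hu.memLp_gradient K hKG hK) (hac.mono hKG)).add
        (memLp_smul_continuousOn hK (hu.memLp K hKG hK) (hgc.mono hKG))) fun η hη v => ?_
  have hda : ContDiffOn ℝ ∞ (fun x => fderiv ℝ a x v) G := fun x hx =>
    (contDiffAt_fderiv_apply (haA x hx) v).contDiffWithinAt
  have h1 := hη.mul_contDiffOn hG ha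
  have h2 := hη.mul_contDiffOn hG hda
  have hI := hu.hasWeakGradientOn.integral_eq _ h1.1 h1.2 h1.3 v
  have hi1 := (hu.integrable_test_mul hG (h1.fderiv_apply v)).integrableOn (s := G)
  have hi2 := (hu.integrable_test_mul hG h2).integrableOn (s := G)
  have hi3 := (hu.integrable_test_mul_inner hG h1 v).integrableOn (s := G)
  have e1 : ∫ x in G, a x * u x * fderiv ℝ η x v =
      ∫ x in G, (u x * fderiv ℝ (fun x => η x * a x) x v - u x * (η x * fderiv ℝ a x v)) := by
    refine setIntegral_congr_fun hG.measurableSet fun x hx => ?_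
    have hd : fderiv ℝ (fun x => η x * a x) x v = η x * fderiv ℝ a x v + a x * fderiv ℝ η x v := by
      rw [fderiv_fun_mul (hη.1.differentiable (by simp) x) ((haA x hx).differentiableAt (by simp))]
      simp
    simp only [hd]
    ring
  have e2 : ∫ x in G, ⟪a x • g x + u x • ∇ a x, v⟫ * η x =
      ∫ x in G, (⟪g x, v⟫ * (η x * a x) + u x * (η x * fderiv ℝ a x v)) := by
    refine setIntegral_congr_fun hG.measurableSet fun x _ => ?_
    simp only [inner_add_left, real_inner_smul_left, inner_gradient_left]
    ring
  rw [e1, e2, integral_sub hi1 hi2, integral_add hi3 hi2, hI]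
  ring

theorem const_one (hG : IsOpen G) : MemH1Loc G (fun _ => 1) (fun _ => 0) := by
  refine of_memLp hG (fun K _ hK => memLp_of_continuousOn_isCompact hK 2 continuousOn_const)
    (fun K _ hK => memLp_of_continuousOn_isCompact hK 2 continuousOn_const) fun η hη v => ?_
  have hi : Integrable η := hη.1.continuous.integrable_of_hasCompactSupport hη.2
  have hd := hη.fderiv_apply v
  have hi' : Integrable (fun x => fderiv ℝ η x v) :=
    hd.1.continuous.integrable_of_hasCompactSupport hd.2
  have := integral_mul_fderiv_eq_neg_fderiv_mul_of_integrable (μ := volume) (𝕜 := ℝ)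
    (f := fun _ : EuclideanSpace ℝ (Fin N) => (1 : ℝ)) (g := η) (v := v)
    (by simp) (by simpa using hi') (by simpa using hi) (fun x _ => differentiableAt_const _)
    (fun x _ => hη.1.differentiable (by simp) x)
  rw [setIntegral_eq_integral_of_forall_compl_eq_zero fun x hx => ?_, this]
  · simp
  · rw [one_mul]
    exact image_eq_zero_of_notMem_tsupport (f := fun x => fderiv ℝ η x v)
      fun h => hx (hd.tsupport_subset h)

theorem of_contDiffOn (hG : IsOpen G) {a : EuclideanSpace ℝ (Fin N) → ℝ}
    (ha : ContDiffOn ℝ ∞ a G) : MemH1Loc G a (∇ a) := by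
  simpa using (const_one hG).smooth_mul hG ha

end MemH1Loc

namespace MemH1Compact

variable {φ : EuclideanSpace ℝ (Fin N) → ℝ}
  {ψ : EuclideanSpace ℝ (Fin N) → EuclideanSpace ℝ (Fin N)}

theorem memH1Loc (h : MemH1Compact G φ ψ) : MemH1Loc G φ ψ :=
  ⟨h.1, fun _ hKG _ => h.memLp.mono_measure (Measure.restrict_mono hKG le_rfl),
    fun _ hKG _ => h.memLp_gradient.mono_measure (Measure.restrict_mono hKG le_rfl)⟩

/-- The weak gradient vanishes almost everywhere off the support. -/
theorem exists_support (hG : IsOpen G) (h : MemH1Compact G φ ψ) :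
    ∃ K ⊆ G, IsCompact K ∧ (∀ᵐ x ∂(volume.restrict G), x ∉ K → φ x = 0) ∧
      ∀ᵐ x ∂(volume.restrict G), x ∉ K → ψ x = 0 := by
  obtain ⟨K, hKG, hK, hφ⟩ := h.compact_support
  refine ⟨K, hKG, hK, hφ, ?_⟩
  have hO : IsOpen (G \ K) := hG.sdiff hK.isClosed
  have key : ∀ᵐ x, x ∈ G \ K → ψ x = 0 := by
    refine hO.ae_eq_zero_of_integral_contDiff_smul_eq_zero
      (h.1.locallyIntegrableOn_gradient.mono_set sdiff_subset) fun η h1 h2 h3 => ?_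
    have hη : IsTest G η := ⟨h1, h2, h3.trans sdiff_subset⟩
    have hint : Integrable (fun x => η x • ψ x) :=
      hη.integrable_smul fun K => h.1.integrableOn_gradient hG
    refine ext_inner_left ℝ fun v => ?_
    rw [← integral_inner hint v, inner_zero_right]
    have hI := h.1.integral_eq η h1 h2 hη.3 v
    have hz : ∫ x in G, φ x * fderiv ℝ η x v = 0 := by
      refine integral_eq_zero_of_ae ?_
      filter_upwards [hφ] with x hx
      by_cases hxK : x ∈ K
      · have hnot : x ∉ tsupport η := fun hx' => (h3 hx').2 hxK
        have : fderiv ℝ η x v = 0 := image_eq_zero_of_notMem_tsupport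
          (f := fun x => fderiv ℝ η x v) fun h' => hnot (tsupport_fderiv_apply_subset ℝ v h')
        simp [this]
      · simp [hx hxK]
    rw [hz, setIntegral_eq_integral_of_forall_compl_eq_zero fun x hx => ?_] at hI
    · rw [zero_eq_neg] at hI
      rw [← hI]
      refine integral_congr_ae (Eventually.of_forall fun x => ?_)
      simp only [real_inner_smul_right, real_inner_comm v (ψ x)]
      rw [real_inner_comm, mul_comm]
    · rw [image_eq_zero_of_notMem_tsupport fun h' => hx (hη.3 h'), mul_zero]
  rw [ae_restrict_iff' hG.measurableSet]
  filter_upwards [key] with x hx hxG hxK using hx ⟨hxG, hxK⟩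

theorem integrableOn_inner (hG : IsOpen G) (hu : MemH1Loc G u g) (h : MemH1Compact G φ ψ) :
    IntegrableOn (fun x => ⟪g x, ψ x⟫) G := by
  obtain ⟨K, hKG, hK, -, hψ⟩ := h.exists_support hG
  have hK' : IntegrableOn (fun x => ⟪g x, ψ x⟫) K :=
    integrable_inner_of_memLp (hu.memLp_gradient K hKG hK) (h.memH1Loc.memLp_gradient K hKG hK)
  refine hK'.of_ae_sdiff_eq_zero hG.measurableSet.nullMeasurableSet ?_
  rw [ae_restrict_iff' hG.measurableSet] at hψ
  filter_upwards [hψ] with x hx hxGK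
  rw [hx hxGK.1 hxGK.2, inner_zero_right]

theorem integrableOn_mul (hG : IsOpen G) {V : EuclideanSpace ℝ (Fin N) → ℝ}
    (hV : ContinuousOn V G) (hu : MemH1Loc G u g) (h : MemH1Compact G φ ψ) :
    IntegrableOn (fun x => V x * u x * φ x) G := by
  obtain ⟨K, hKG, hK, hφ⟩ := h.compact_support
  have hK' : IntegrableOn (fun x => V x * u x * φ x) K :=
    (memLp_continuousOn_smul hK (hu.memLp K hKG hK) (hV.mono hKG)).integrable_mul
      (h.memH1Loc.memLp K hKG hK)
  refine hK'.of_ae_sdiff_eq_zero hG.measurableSet.nullMeasurableSet ?_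
  rw [ae_restrict_iff' hG.measurableSet] at hφ
  filter_upwards [hφ] with x hx hxGK
  rw [hx hxGK.1 hxGK.2, mul_zero]

/-- Green's formula for a smooth function and a compactly supported Sobolev function. -/
theorem integral_inner_gradient (hG : IsOpen G) {S : EuclideanSpace ℝ (Fin N) → ℝ}
    (hS : ContDiffOn ℝ ∞ S G) (h : MemH1Compact G φ ψ) :
    ∫ x in G, ⟪∇ S x, ψ x⟫ = ∫ x in G, -Δ S x * φ x := by
  obtain ⟨K, hKG, hK, hφ, hψ⟩ := h.exists_support hG
  obtain ⟨χ, hχ, hχc, hχG, hχ1⟩ := exists_cutoff hG hK hKG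
  have hSA : ∀ x ∈ G, ContDiffAt ℝ ∞ S x := fun x hx => hS.contDiffAt (hG.mem_nhds hx)
  set e : Fin N → EuclideanSpace ℝ (Fin N) := fun i => EuclideanSpace.single i 1 with he
  have hη : ∀ i, IsTest G (fun x => χ x * fderiv ℝ S x (e i)) := fun i =>
    IsTest.mul_contDiffOn ⟨hχ, hχc, hχG⟩ hG fun x hx =>
      (contDiffAt_fderiv_apply (hSA x hx) (e i)).contDiffWithinAt
  have hI : ∑ i, ∫ x in G, ⟪ψ x, e i⟫ * (χ x * fderiv ℝ S x (e i)) =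
      ∑ i, -∫ x in G, φ x * fderiv ℝ (fun x => χ x * fderiv ℝ S x (e i)) x (e i) :=
    Finset.sum_congr rfl fun i _ => by
      rw [h.1.integral_eq _ (hη i).1 (hη i).2 (hη i).3, neg_neg]
  rw [Finset.sum_neg_distrib, ← integral_finsetSum _ fun i _ =>
      (h.memH1Loc.integrable_test_mul_inner hG (hη i) (e i)).integrableOn,
    ← integral_finsetSum _ fun i _ =>
      (h.memH1Loc.integrable_test_mul hG ((hη i).fderiv_apply (e i))).integrableOn,
    ← integral_neg] at hI
  have e1 : ∫ x in G, ⟪∇ S x, ψ x⟫ =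
      ∫ x in G, ∑ i, ⟪ψ x, e i⟫ * (χ x * fderiv ℝ S x (e i)) := by
    refine integral_congr_ae ?_
    filter_upwards [hψ] with x hx
    by_cases hxK : x ∈ K
    · have h1 : χ x = 1 := (hχ1 x hxK).eq_of_nhds
      have := (EuclideanSpace.basisFun (Fin N) ℝ).sum_inner_mul_inner (ψ x) (∇ S x)
      rw [real_inner_comm, ← this]
      refine Finset.sum_congr rfl fun i _ => ?_
      simp only [h1, one_mul, EuclideanSpace.basisFun_apply, he]
      rw [real_inner_comm (∇ S x), inner_gradient_left]
    · simp [hx hxK]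
  have e2 : ∫ x in G, -Δ S x * φ x = ∫ x in G,
      -∑ i, φ x * fderiv ℝ (fun x => χ x * fderiv ℝ S x (e i)) x (e i) := by
    refine integral_congr_ae ?_
    filter_upwards [hφ, ae_restrict_mem hG.measurableSet] with x hx hxG
    by_cases hxK : x ∈ K
    · rw [laplacian_eq_sum_fderiv ((hSA x hxG).of_le (WithTop.coe_le_coe.2 le_top)),
        ← Finset.mul_sum, neg_mul, mul_comm]
      congr 2
      refine Finset.sum_congr rfl fun i _ => ?_
      have : (fun x => χ x * fderiv ℝ S x (e i)) =ᶠ[𝓝 x] fun x => fderiv ℝ S x (e i) := by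
        filter_upwards [hχ1 x hxK] with y hy
        simp [hy]
      rw [this.fderiv_eq]
    · simp [hx hxK]
  rw [e1, e2, hI]

/-- Extension by zero to a larger open set. -/
theorem indicator {G' : Set (EuclideanSpace ℝ (Fin N))} (hG : IsOpen G) (hG' : IsOpen G')
    (hsub : G' ⊆ G) (h : MemH1Compact G' φ ψ) :
    MemH1Compact G (G'.indicator φ) (G'.indicator ψ) := by
  obtain ⟨K, hKG, hK, hφ, hψ⟩ := h.exists_support hG'
  have hm := hG'.measurableSet
  have hrr : (volume.restrict G).restrict G' =
      (volume : Measure (EuclideanSpace ℝ (Fin N))).restrict G' := by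
    rw [Measure.restrict_restrict hm, inter_eq_left.2 hsub]
  have hL1 : MemLp (G'.indicator φ) 2 (volume.restrict G) :=
    (memLp_indicator_iff_restrict hm).2 (hrr ▸ h.memLp)
  have hL2 : MemLp (G'.indicator ψ) 2 (volume.restrict G) :=
    (memLp_indicator_iff_restrict hm).2 (hrr ▸ h.memLp_gradient)
  have hloc : MemH1Loc G (G'.indicator φ) (G'.indicator ψ) := by
    refine MemH1Loc.of_memLp hG
      (fun L hLG _ => hL1.mono_measure (Measure.restrict_mono hLG le_rfl))
      (fun L hLG _ => hL2.mono_measure (Measure.restrict_mono hLG le_rfl)) fun η hη v => ?_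
    obtain ⟨χ, hχ, hχc, hχG, hχ1⟩ := exists_cutoff hG' hK hKG
    have ht : IsTest G' (fun x => χ x * η x) :=
      IsTest.mul_contDiffOn ⟨hχ, hχc, hχG⟩ hG' hη.1.contDiffOn
    have hI := h.1.integral_eq _ ht.1 ht.2 ht.3 v
    have e1 : ∫ x in G, G'.indicator φ x * fderiv ℝ η x v =
        ∫ x in G', φ x * fderiv ℝ (fun x => χ x * η x) x v := by
      have : (fun x => G'.indicator φ x * fderiv ℝ η x v) =
          G'.indicator (fun x => φ x * fderiv ℝ η x v) := by
        ext x; rw [indicator_mul_left]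
      rw [this, setIntegral_indicator hm, inter_eq_right.2 hsub]
      refine integral_congr_ae ?_
      filter_upwards [hφ] with x hx
      by_cases hxK : x ∈ K
      · have : (fun x => χ x * η x) =ᶠ[𝓝 x] η := by
          filter_upwards [hχ1 x hxK] with y hy
          simp [hy]
        rw [this.fderiv_eq]
      · simp [hx hxK]
    have e2 : ∫ x in G, ⟪G'.indicator ψ x, v⟫ * η x = ∫ x in G', ⟪ψ x, v⟫ * (χ x * η x) := by
      have : (fun x => ⟪G'.indicator ψ x, v⟫ * η x) =
          G'.indicator (fun x => ⟪ψ x, v⟫ * η x) := by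
        ext x
        by_cases hx : x ∈ G' <;> simp [hx]
      rw [this, setIntegral_indicator hm, inter_eq_right.2 hsub]
      refine integral_congr_ae ?_
      filter_upwards [hψ] with x hx
      by_cases hxK : x ∈ K
      · simp [(hχ1 x hxK).eq_of_nhds]
      · simp [hx hxK]
    rw [e1, e2, hI]
  refine ⟨hloc.1, hL1, hL2, K, hKG.trans hsub, hK, ?_⟩
  rw [ae_restrict_iff' hm] at hφ
  refine ae_restrict_of_ae ?_
  filter_upwards [hφ] with x hx hxK
  by_cases hxG : x ∈ G'
  · simp [hxG, hx hxG hxK]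
  · simp [hxG]

end MemH1Compact

end WeakGradient

/-! ### The chain rule for weak gradients -/

section ChainRule

variable {G : Set (EuclideanSpace ℝ (Fin N))} {u : EuclideanSpace ℝ (Fin N) → ℝ}
  {g : EuclideanSpace ℝ (Fin N) → EuclideanSpace ℝ (Fin N)}

theorem abs_normed_convolution_le {E : Type*} [NormedAddCommGroup E] [NormedSpace ℝ E]
    [FiniteDimensional ℝ E] [MeasurableSpace E] [BorelSpace E] {m : Measure E}
    [m.IsAddHaarMeasure] (b : ContDiffBump (0 : E)) {f : E → ℝ} (hf : AEStronglyMeasurable f m)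
    {C : ℝ} (hC : ∀ x, |f x| ≤ C) (x : E) :
    |(b.normed m ⋆[ContinuousLinearMap.lsmul ℝ ℝ, m] f) x| ≤ C := by
  have h := dist_convolution_le (z₀ := (0 : ℝ)) (x₀ := x) (μ := m)
    ((abs_nonneg _).trans (hC 0)) b.support_normed_eq.subset b.nonneg_normed b.integral_normed hf
    (fun y _ => by simpa using hC y)
  simpa using h

theorem isTest_normed_sub {K₁ : Set (EuclideanSpace ℝ (Fin N))} (hKG : K₁ ⊆ G)
    (b : ContDiffBump (0 : EuclideanSpace ℝ (Fin N))) {x : EuclideanSpace ℝ (Fin N)}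
    (hx : Metric.closedBall x b.rOut ⊆ K₁) :
    IsTest G (fun y => b.normed volume (x - y)) ∧
      ∀ y ∉ K₁, b.normed volume (x - y) = 0 := by
  have hsub : tsupport (fun y => b.normed volume (x - y)) ⊆ Metric.closedBall x b.rOut := by
    refine closure_minimal (fun y hy => ?_) Metric.isClosed_closedBall
    have : x - y ∈ Function.support (b.normed volume) := hy
    rw [b.support_normed_eq, mem_ball_zero_iff] at this
    rw [Metric.mem_closedBall, dist_comm, dist_eq_norm]
    exact this.le
  exact ⟨⟨b.contDiff_normed.comp (contDiff_const.sub contDiff_id),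
    (isCompact_closedBall x b.rOut).of_isClosed_subset (isClosed_tsupport _) hsub,
    hsub.trans (hx.trans hKG)⟩,
    fun y hy => image_eq_zero_of_notMem_tsupport (f := fun y => b.normed volume (x - y))
      fun h => hy (hx (hsub h))⟩

/-- The derivative of a mollification is the mollification of the weak derivative. -/
theorem fderiv_mollification (hG : IsOpen G) (hu : MemH1Loc G u g)
    {K₁ : Set (EuclideanSpace ℝ (Fin N))} (hK₁ : IsCompact K₁) (hKG : K₁ ⊆ G)
    (b : ContDiffBump (0 : EuclideanSpace ℝ (Fin N))) {x : EuclideanSpace ℝ (Fin N)}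
    (hx : Metric.closedBall x b.rOut ⊆ K₁) (v : EuclideanSpace ℝ (Fin N)) :
    fderiv ℝ (b.normed volume ⋆[ContinuousLinearMap.lsmul ℝ ℝ, volume] K₁.indicator u) x v =
      ∫ y, b.normed volume (x - y) * K₁.indicator (fun y => ⟪g y, v⟫) y := by
  have hui : Integrable (K₁.indicator u) :=
    (hu.hasWeakGradientOn.integrableOn hG hKG hK₁).integrable_indicator hK₁.measurableSet
  have hswap : (b.normed volume ⋆[ContinuousLinearMap.lsmul ℝ ℝ, volume] K₁.indicator u) =
      (K₁.indicator u ⋆[ContinuousLinearMap.lsmul ℝ ℝ, volume] b.normed volume) := by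
    ext z
    rw [convolution_lsmul_swap, convolution_lsmul]
    simp only [smul_eq_mul, mul_comm]
  have hb1 : ContDiff ℝ 1 (b.normed volume) := b.contDiff_normed
  have hd := b.hasCompactSupport_normed.hasFDerivAt_convolution_right (μ := volume)
    (ContinuousLinearMap.lsmul ℝ ℝ) hui.locallyIntegrable hb1 x
  rw [hswap, hd.fderiv, convolution_precompR_apply _ hui.locallyIntegrable
    (b.hasCompactSupport_normed.fderiv ℝ) (hb1.continuous_fderiv (by simp)), convolution_lsmul]
  obtain ⟨ht, h0⟩ := isTest_normed_sub hKG b hx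
  have hI := hu.hasWeakGradientOn.integral_eq _ ht.1 ht.2 ht.3 v
  have hfd : ∀ y, fderiv ℝ (fun y => b.normed volume (x - y)) y v =
      -fderiv ℝ (b.normed volume) (x - y) v := by
    intro y
    have h1 : HasFDerivAt (b.normed volume) (fderiv ℝ (b.normed volume) (x - y)) (x - y) :=
      (hb1.differentiable (by simp) _).hasFDerivAt
    have h2 : HasFDerivAt (fun y => x - y) (-ContinuousLinearMap.id ℝ _) y :=
      (hasFDerivAt_id y).const_sub x
    have h3 : HasFDerivAt (fun y => b.normed volume (x - y)) _ y := h1.comp y h2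
    rw [h3.fderiv]
    simp
  -- the test function and its derivative vanish off `K₁`
  have hd0 : ∀ y ∉ K₁, fderiv ℝ (fun y => b.normed volume (x - y)) y v = 0 := by
    intro y hy
    refine image_eq_zero_of_notMem_tsupport
      (f := fun y => fderiv ℝ (fun y => b.normed volume (x - y)) y v) fun h => hy ?_
    have h1 : tsupport (fun y => b.normed volume (x - y)) ⊆ K₁ :=
      closure_minimal (fun z hz => by_contra fun h => hz (h0 z h)) hK₁.isClosed
    exact h1 (tsupport_fderiv_apply_subset ℝ v h)
  rw [setIntegral_eq_integral_of_forall_compl_eq_zero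
      (fun y hy => by rw [hd0 y fun h => hy (hKG h), mul_zero]),
    setIntegral_eq_integral_of_forall_compl_eq_zero
      (fun y hy => by rw [h0 y fun h => hy (hKG h), mul_zero]), ← integral_neg] at hI
  have e1 : ∫ y, K₁.indicator u y • fderiv ℝ (b.normed volume) (x - y) v =
      -∫ y, u y * fderiv ℝ (fun y => b.normed volume (x - y)) y v := by
    rw [← integral_neg]
    refine integral_congr_ae (Eventually.of_forall fun y => ?_)
    by_cases hy : y ∈ K₁
    · simp [hy, hfd]
    · simp [hy, hd0 y hy]
  rw [e1, hI, ← integral_neg]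
  refine integral_congr_ae (Eventually.of_forall fun y => ?_)
  by_cases hy : y ∈ K₁
  · simp [hy, mul_comm]
  · simp [hy, h0 y hy]

theorem integral_mul_mollification_eq (b : ContDiffBump (0 : EuclideanSpace ℝ (Fin N)))
    {a f : EuclideanSpace ℝ (Fin N) → ℝ} (ha : Integrable a) (hf : Integrable f) :
    ∫ x, a x * ∫ y, b.normed volume (x - y) * f y =
      ∫ y, f y * (b.normed volume ⋆[ContinuousLinearMap.lsmul ℝ ℝ, volume] a) y := by
  have hint : Integrable (Function.uncurry fun x y => a x * (b.normed volume (x - y) * f y))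
      ((volume : Measure (EuclideanSpace ℝ (Fin N))).prod volume) := by
    obtain ⟨C, hC⟩ := (b.hasCompactSupport_normed (μ := volume)).exists_bound_of_continuous
      b.continuous_normed
    have hc : Continuous fun z : EuclideanSpace ℝ (Fin N) × EuclideanSpace ℝ (Fin N) =>
        b.normed volume (z.1 - z.2) := b.continuous_normed.comp (by fun_prop)
    have := (ha.mul_prod hf).bdd_mul (c := C) hc.aestronglyMeasurable
      (Eventually.of_forall fun z => hC _)
    refine this.congr (Eventually.of_forall fun z => ?_)
    simp only [Function.uncurry]
    ring
  calc ∫ x, a x * ∫ y, b.normed volume (x - y) * f y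
      = ∫ x, ∫ y, a x * (b.normed volume (x - y) * f y) := by simp only [integral_const_mul]
    _ = ∫ y, ∫ x, a x * (b.normed volume (x - y) * f y) := integral_integral_swap hint
    _ = _ := by
      refine integral_congr_ae (Eventually.of_forall fun y => ?_)
      simp only [convolution_lsmul_swap, smul_eq_mul]
      rw [← integral_const_mul]
      refine integral_congr_ae (Eventually.of_forall fun x => ?_)
      simp only
      rw [← b.normed_neg (x - y), neg_sub]
      ring

/-- Chain rule for a continuous Sobolev function and a `C¹` outer function. The function is
mollified, and the mollifier is then moved onto the test function, so that only pointwise bounded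
convergence of mollifications of continuous functions is needed. -/
theorem MemH1Loc.comp_hasDerivAt (hG : IsOpen G) (hu : MemH1Loc G u g) (huc : ContinuousOn u G)
    {F F' : ℝ → ℝ} (hF : ∀ t, HasDerivAt F (F' t) t) (hF' : Continuous F') :
    MemH1Loc G (fun x => F (u x)) (fun x => F' (u x) • g x) := by
  have hFc : Continuous F := continuous_iff_continuousAt.2 fun t => (hF t).continuousAt
  refine of_memLp hG
    (fun K hKG hK => memLp_of_continuousOn_isCompact hK 2 (hFc.comp_continuousOn (huc.mono hKG)))
    (fun K hKG hK => memLp_continuousOn_smul hK (hu.memLp_gradient K hKG hK)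
      (hF'.comp_continuousOn (huc.mono hKG))) fun η hη v => ?_
  obtain ⟨d, hd, hdG⟩ := hη.hasCompactSupport.exists_cthickening_subset_open hG hη.3
  set K := tsupport η with hK
  set K₁ := Metric.cthickening d K with hK₁
  have hK₁c : IsCompact K₁ := IsCompact.cthickening hη.2
  have hKint : K ⊆ interior K₁ := (Metric.self_subset_thickening hd K).trans
    (interior_maximal (Metric.thickening_subset_cthickening d K) Metric.isOpen_thickening)
  have huK₁ : ContinuousOn u K₁ := huc.mono hdG
  set U := K₁.indicator u with hU
  have hUi : Integrable U :=
    (hu.hasWeakGradientOn.integrableOn hG hdG hK₁c).integrable_indicator hK₁c.measurableSet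
  set gv := K₁.indicator (fun y => ⟪g y, v⟫) with hgv
  have hgi : Integrable gv := IntegrableOn.integrable_indicator
    ((hu.hasWeakGradientOn.integrableOn_gradient hG hdG hK₁c).inner_const v) hK₁c.measurableSet
  obtain ⟨B, hB⟩ := hK₁c.exists_bound_of_continuousOn huK₁
  have hB0 : ∀ x, |U x| ≤ max B 0 := by
    intro x
    by_cases hx : x ∈ K₁
    · rw [hU, indicator_of_mem hx]; exact (hB x hx).trans (le_max_left _ _)
    · rw [hU, indicator_of_notMem hx]; simp
  have hUat : ∀ x ∈ interior K₁, ContinuousAt U x := fun x hx => by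
    refine (huK₁.continuousAt (mem_interior_iff_mem_nhds.1 hx)).congr ?_
    filter_upwards [mem_interior_iff_mem_nhds.1 hx] with y hy
    rw [hU, indicator_of_mem hy]
  have hUeq : ∀ x ∈ K₁, U x = u x := fun x hx => by rw [hU, indicator_of_mem hx]
  -- mollifiers of radius tending to zero
  let b : ℕ → ContDiffBump (0 : EuclideanSpace ℝ (Fin N)) := fun n =>
    ⟨d / (n + 1) / 2, d / (n + 1), by positivity, half_lt_self (by positivity)⟩
  have hbr : ∀ n, (b n).rOut ≤ d := fun n => div_le_self hd.le (by
    have : (0 : ℝ) ≤ n := n.cast_nonneg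
    linarith)
  have hb0 : Tendsto (fun n => (b n).rOut) atTop (𝓝 0) := by
    have := (tendsto_one_div_add_atTop_nhds_zero_nat (𝕜 := ℝ)).const_mul d
    simpa [b, div_eq_mul_inv] using this
  have hball : ∀ n, ∀ x ∈ K, Metric.closedBall x (b n).rOut ⊆ K₁ := fun n x hx =>
    (Metric.closedBall_subset_closedBall (hbr n)).trans
      (Metric.closedBall_subset_cthickening hx d)
  set un : ℕ → EuclideanSpace ℝ (Fin N) → ℝ := fun n =>
    (b n).normed volume ⋆[ContinuousLinearMap.lsmul ℝ ℝ, volume] U with hun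
  have hunB : ∀ n x, |un n x| ≤ max B 0 := fun n x =>
    abs_normed_convolution_le (b n) hUi.aestronglyMeasurable hB0 x
  have hunC : ∀ n, ContDiff ℝ ∞ (un n) := fun n =>
    (b n).hasCompactSupport_normed.contDiff_convolution_left (n := ⊤)
      (ContinuousLinearMap.lsmul ℝ ℝ) (b n).contDiff_normed hUi.locallyIntegrable
  have hunlim : ∀ y ∈ interior K₁, Tendsto (fun z : ℕ × EuclideanSpace ℝ (Fin N) => un z.1 z.2)
      (atTop ×ˢ 𝓝 y) (𝓝 (U y)) := fun y hy =>
    ContDiffBump.convolution_tendsto_right (φ := fun z : ℕ × EuclideanSpace ℝ (Fin N) => b z.1)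
      (g := fun _ => U) (k := fun z => z.2) (x₀ := y) (hb0.comp tendsto_fst)
      (Eventually.of_forall fun _ => hUi.aestronglyMeasurable)
      ((hUat y hy).tendsto.comp tendsto_snd) tendsto_snd
  obtain ⟨C, hC⟩ := (isCompact_Icc (a := -max B 0) (b := max B 0)).exists_bound_of_continuousOn
    hFc.continuousOn
  obtain ⟨C', hC'⟩ := (isCompact_Icc (a := -max B 0) (b := max B 0)).exists_bound_of_continuousOn
    hF'.continuousOn
  obtain ⟨A, hA⟩ := hη.2.exists_bound_of_continuous hη.1.continuous
  have hdη := hη.fderiv_apply v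
  have hη0 : ∀ x ∉ K, η x = 0 := fun x hx => image_eq_zero_of_notMem_tsupport hx
  have hdη0 : ∀ x ∉ K, fderiv ℝ η x v = 0 := fun x hx =>
    image_eq_zero_of_notMem_tsupport (f := fun x => fderiv ℝ η x v)
      fun h => hx (tsupport_fderiv_apply_subset ℝ v h)
  set an : ℕ → EuclideanSpace ℝ (Fin N) → ℝ := fun n x => F' (un n x) * η x with han
  have hanc : ∀ n, Continuous (an n) := fun n =>
    (hF'.comp (hunC n).continuous).mul hη.1.continuous
  have hansupp : ∀ n, HasCompactSupport (an n) := fun n => hη.2.mul_left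
  have hanB : ∀ n x, |an n x| ≤ |C'| * A := fun n x => by
    rw [han, abs_mul]
    exact mul_le_mul ((hC' _ (abs_le.1 (hunB n x))).trans (le_abs_self _)) (hA x) (abs_nonneg _)
      (abs_nonneg _)
  -- integration by parts for the mollified function
  have hparts : ∀ n, ∫ x, F (un n x) * fderiv ℝ η x v =
      -∫ y, gv y * ((b n).normed volume ⋆[ContinuousLinearMap.lsmul ℝ ℝ, volume] an n) y := by
    intro n
    have hfd : ∀ x, HasFDerivAt (fun x => F (un n x)) (F' (un n x) • fderiv ℝ (un n) x) x :=
      fun x => (hF _).comp_hasFDerivAt x ((hunC n).differentiable (by simp) x).hasFDerivAt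
    have hcont : Continuous fun x => F (un n x) := hFc.comp (hunC n).continuous
    have hcd : Continuous fun x => fderiv ℝ (fun x => F (un n x)) x v := by
      simp only [(hfd _).fderiv, smul_apply, smul_eq_mul]
      exact (hF'.comp (hunC n).continuous).mul
        (((hunC n).continuous_fderiv (by simp)).clm_apply continuous_const)
    have h1 := integral_mul_fderiv_eq_neg_fderiv_mul_of_integrable (μ := volume) (𝕜 := ℝ)
      (f := fun x => F (un n x)) (g := η) (v := v)
      ((hcd.mul hη.1.continuous).integrable_of_hasCompactSupport hη.2.mul_left)
      ((hcont.mul hdη.1.continuous).integrable_of_hasCompactSupport hdη.2.mul_left)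
      ((hcont.mul hη.1.continuous).integrable_of_hasCompactSupport hη.2.mul_left)
      (fun x _ => (hfd x).differentiableAt) (fun x _ => hη.1.differentiable (by simp) x)
    rw [h1, ← integral_mul_mollification_eq (b n)
      ((hanc n).integrable_of_hasCompactSupport (hansupp n)) hgi]
    congr 1
    refine integral_congr_ae (Eventually.of_forall fun x => ?_)
    by_cases hx : x ∈ K
    · simp only [(hfd x).fderiv, smul_apply, smul_eq_mul]
      rw [← fderiv_mollification hG hu hK₁c hdG (b n) (hball n x hx) v]
      simp only [han]
      ring
    · simp [han, hη0 x hx]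
  have hlim1 : Tendsto (fun n => ∫ x, F (un n x) * fderiv ℝ η x v) atTop
      (𝓝 (∫ x, F (u x) * fderiv ℝ η x v)) := by
    refine tendsto_integral_of_dominated_convergence (fun x => C * |fderiv ℝ η x v|)
      (fun n => ((hFc.comp (hunC n).continuous).mul hdη.1.continuous).aestronglyMeasurable)
      ((hdη.1.continuous.integrable_of_hasCompactSupport hdη.2).abs.const_mul C)
      (fun n => Eventually.of_forall fun x => ?_) (Eventually.of_forall fun x => ?_)
    · rw [norm_mul]
      exact mul_le_mul_of_nonneg_right (hC _ (abs_le.1 (hunB n x))) (abs_nonneg _)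
    · by_cases hx : x ∈ K
      · have h2 := (hunlim x (hKint hx)).comp
          (tendsto_id.prodMk (tendsto_const_nhds : Tendsto (fun _ : ℕ => x) atTop (𝓝 x)))
        rw [hUeq x (interior_subset (hKint hx))] at h2
        exact ((hFc.tendsto _).comp h2).mul_const _
      · simp [hdη0 x hx]
  have hlim2 : Tendsto (fun n => ∫ y, gv y *
      ((b n).normed volume ⋆[ContinuousLinearMap.lsmul ℝ ℝ, volume] an n) y) atTop
      (𝓝 (∫ y, gv y * (F' (u y) * η y))) := by
    refine tendsto_integral_of_dominated_convergence (fun y => |gv y| * (|C'| * A))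
      (fun n => hgi.aestronglyMeasurable.mul ?_) (hgi.abs.mul_const _)
      (fun n => Eventually.of_forall fun x => ?_) (Eventually.of_forall fun y => ?_)
    · exact ((b n).hasCompactSupport_normed.contDiff_convolution_left (n := 0)
        (ContinuousLinearMap.lsmul ℝ ℝ) (b n).contDiff_normed
        (hanc n).locallyIntegrable).continuous.aestronglyMeasurable
    · rw [norm_mul]
      exact mul_le_mul_of_nonneg_left
        (abs_normed_convolution_le (b n) (hanc n).aestronglyMeasurable (hanB n) x) (abs_nonneg _)
    · refine Tendsto.const_mul _ (ContDiffBump.convolution_tendsto_right hb0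
        (Eventually.of_forall fun n => (hanc n).aestronglyMeasurable) ?_ tendsto_const_nhds)
      by_cases hy : y ∈ K
      · have h2 := hunlim y (hKint hy)
        rw [hUeq y (interior_subset (hKint hy))] at h2
        exact ((hF'.tendsto _).comp h2).mul ((hη.1.continuous.tendsto y).comp tendsto_snd)
      · rw [hη0 y hy, mul_zero]
        refine tendsto_const_nhds.congr' ?_
        have : ∀ᶠ z in 𝓝 y, η z = 0 := notMem_tsupport_iff_eventuallyEq.1 hy
        filter_upwards [tendsto_snd.eventually this] with z hz
        simp [Function.uncurry, han, hz]
  have hlim := tendsto_nhds_unique hlim1 (by simpa only [hparts] using hlim2.neg)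
  rw [setIntegral_eq_integral_of_forall_compl_eq_zero
      (fun x hx => by rw [hdη0 x fun h => hx (hη.3 h), mul_zero]),
    setIntegral_eq_integral_of_forall_compl_eq_zero
      (fun x hx => by rw [hη0 x fun h => hx (hη.3 h), mul_zero]), hlim]
  congr 1
  refine integral_congr_ae (Eventually.of_forall fun y => ?_)
  by_cases hy : y ∈ K
  · simp only [hgv, indicator_of_mem (interior_subset (hKint hy)), real_inner_smul_left]
    ring
  · simp [hη0 y hy]

end ChainRule

/-! ### The maximum principle -/

theorem hasDerivAt_max_zero_pow {n : ℕ} (hn : 1 < n) (t : ℝ) :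
    HasDerivAt (fun t : ℝ => max t 0 ^ n) (n * max t 0 ^ (n - 1)) t := by
  rcases lt_trichotomy t 0 with ht | ht | ht
  · have h : (fun t : ℝ => max t 0 ^ n) =ᶠ[𝓝 t] fun _ => 0 := by
      filter_upwards [gt_mem_nhds ht] with s hs
      rw [max_eq_right hs.le, zero_pow (by omega)]
    rw [max_eq_right ht.le, zero_pow (by omega), mul_zero]
    exact (hasDerivAt_const t 0).congr_of_eventuallyEq h
  · subst ht
    have h : (fun t : ℝ => max t 0 ^ n) =O[𝓝 0] fun t => ‖t - 0‖ ^ n := by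
      refine Asymptotics.IsBigO.of_bound 1 (Eventually.of_forall fun s => ?_)
      rw [one_mul, norm_pow, norm_pow, norm_norm, sub_zero]
      refine pow_le_pow_left₀ (norm_nonneg _) ?_ n
      rw [Real.norm_of_nonneg (le_max_right _ _)]
      exact max_le (le_abs_self s) (abs_nonneg s)
    have := (h.hasFDerivAt hn).hasDerivAt
    simpa [zero_pow (show n - 1 ≠ 0 by omega)] using this
  · have h : (fun t : ℝ => max t 0 ^ n) =ᶠ[𝓝 t] fun t => t ^ n := by
      filter_upwards [lt_mem_nhds ht] with s hs
      rw [max_eq_left hs.le]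
    rw [max_eq_left ht.le]
    exact (hasDerivAt_pow n t).congr_of_eventuallyEq h

section MaximumPrinciple

variable {G : Set (EuclideanSpace ℝ (Fin N))} {u : EuclideanSpace ℝ (Fin N) → ℝ}
  {g : EuclideanSpace ℝ (Fin N) → EuclideanSpace ℝ (Fin N)}

theorem MemH1Loc.memH1Compact (hG : IsOpen G) (hu : MemH1Loc G u g)
    {K : Set (EuclideanSpace ℝ (Fin N))} (hKG : K ⊆ G) (hK : IsCompact K)
    (hu0 : ∀ x ∈ G, x ∉ K → u x = 0) (hg0 : ∀ x ∈ G, x ∉ K → g x = 0) :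
    MemH1Compact G u g := by
  have aux : ∀ {F : Type} [NormedAddCommGroup F] (f : EuclideanSpace ℝ (Fin N) → F),
      MemLp f 2 (volume.restrict K) → (∀ x ∈ G, x ∉ K → f x = 0) →
        MemLp f 2 (volume.restrict G) := by
    intro F _ f hf h0
    have h1 : MemLp (K.indicator f) 2 (volume.restrict G) := by
      refine (memLp_indicator_iff_restrict hK.measurableSet).2 ?_
      rwa [Measure.restrict_restrict hK.measurableSet, inter_eq_left.2 hKG]
    refine (memLp_congr_ae ?_).1 h1
    filter_upwards [ae_restrict_mem hG.measurableSet] with x hx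
    by_cases hxK : x ∈ K
    · rw [indicator_of_mem hxK]
    · rw [indicator_of_notMem hxK, h0 x hx hxK]
  exact ⟨hu.1, aux u (hu.memLp K hKG hK) hu0, aux g (hu.memLp_gradient K hKG hK) hg0, K, hKG, hK,
    (ae_restrict_mem hG.measurableSet).mono hu0⟩

/-- Maximum principle: if `-Δ - V` has a smooth positive strict super-solution `S` on `G`, then a
sub-solution that is nonpositive outside a compact subset of `G` is nonpositive. With `z = u / S`,
testing against `S * max z 0 ^ 2` leaves a nonnegative quadratic form in `∇z` plus the integral of
`(-ΔS - V S) * S * max z 0 ^ 3`. -/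
theorem nonpos_of_subsolution (hG : IsOpen G) {V S : EuclideanSpace ℝ (Fin N) → ℝ}
    (hV : ContinuousOn V G) (hS : ContDiffOn ℝ ∞ S G) (hSpos : ∀ x ∈ G, 0 < S x)
    (hLS : ∀ x ∈ G, 0 < -Δ S x - V x * S x) (huc : ContinuousOn u G) (hu : MemH1Loc G u g)
    (hsub : ∀ φ ψ, MemH1Compact G φ ψ → (∀ᵐ x ∂(volume.restrict G), 0 ≤ φ x) →
      (∫ x in G, ⟪g x, ψ x⟫) - ∫ x in G, V x * u x * φ x ≤ 0)
    {K : Set (EuclideanSpace ℝ (Fin N))} (hKG : K ⊆ G) (hK : IsCompact K)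
    (hneg : ∀ x ∈ G, x ∉ K → u x ≤ 0) : ∀ x ∈ G, u x ≤ 0 := by
  have hSA : ∀ x ∈ G, ContDiffAt ℝ ∞ S x := fun x hx => hS.contDiffAt (hG.mem_nhds hx)
  have hSinv : ContDiffOn ℝ ∞ (fun x => (S x)⁻¹) G := hS.inv fun x hx => (hSpos x hx).ne'
  set z : EuclideanSpace ℝ (Fin N) → ℝ := fun x => (S x)⁻¹ * u x with hz
  set ζ := fun x => (S x)⁻¹ • g x + u x • ∇ (fun x => (S x)⁻¹) x with hζ
  have hzH : MemH1Loc G z ζ := hu.smooth_mul hG hSinv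
  have hzc : ContinuousOn z G := hSinv.continuousOn.mul huc
  have hgrad : ∀ x ∈ G, g x = S x • ζ x + z x • ∇ S x := by
    intro x hx
    have hne := (hSpos x hx).ne'
    have h1 : ∇ (fun x => (S x)⁻¹) x = -((S x ^ 2)⁻¹ • ∇ S x) := by
      refine ext_inner_right ℝ fun v => ?_
      have h2 : HasFDerivAt (fun x => (S x)⁻¹) _ x := (hasDerivAt_inv hne).comp_hasFDerivAt x
        ((hSA x hx).differentiableAt (by simp)).hasFDerivAt
      replace h2 := h2.fderiv
      rw [inner_gradient_left, h2, inner_neg_left, real_inner_smul_left, inner_gradient_left]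
      simp
    simp only [hζ, hz, h1]
    match_scalars <;> field_simp
    ring
  have huS : ∀ x ∈ G, u x = S x * z x := fun x hx => by
    simp only [hz]; rw [mul_inv_cancel_left₀ (hSpos x hx).ne']
  have hz0 : ∀ x ∈ G, x ∉ K → max (z x) 0 = 0 := fun x hx hxK =>
    max_eq_right (mul_nonpos_of_nonneg_of_nonpos (inv_nonneg.2 (hSpos x hx).le)
      (hneg x hx hxK))
  have hcomp : ∀ n : ℕ, 1 < n → MemH1Compact G (fun x => S x * max (z x) 0 ^ n)
      (fun x => S x • ((n * max (z x) 0 ^ (n - 1)) • ζ x) + max (z x) 0 ^ n • ∇ S x) := by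
    intro n hn
    have hc := hzH.comp_hasDerivAt hG hzc (hasDerivAt_max_zero_pow hn) (by fun_prop)
    refine (hc.smooth_mul hG hS).memH1Compact hG hKG hK (fun x hx hxK => ?_) fun x hx hxK => ?_
    · simp [hz0 x hx hxK, show n ≠ 0 by omega]
    · simp [hz0 x hx hxK, show n ≠ 0 by omega, show n - 1 ≠ 0 by omega]
  have hφ := hcomp 2 (by norm_num)
  have hχ := hcomp 3 (by norm_num)
  set φ := fun x => S x * max (z x) 0 ^ 2 with hφdef
  set χ := fun x => S x * max (z x) 0 ^ 3 with hχdef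
  have hSH := MemH1Loc.of_contDiffOn hG hS
  have h1 := hsub _ _ hφ (by
    filter_upwards [ae_restrict_mem hG.measurableSet] with x hx
    have := hSpos x hx
    positivity)
  have h2 := setIntegral_mono_on (hχ.integrableOn_inner hG hSH) (hφ.integrableOn_inner hG hu)
    hG.measurableSet (fun x hx => by
      rw [hgrad x hx]
      have hmax : z x * max (z x) 0 = max (z x) 0 ^ 2 := by
        rcases le_total (z x) 0 with h | h
        · simp [max_eq_right h]
        · simp [max_eq_left h, sq]
      have hnn : 0 ≤ S x ^ 2 * (2 * max (z x) 0) * ⟪ζ x, ζ x⟫ := by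
        have := real_inner_self_nonneg (x := ζ x)
        positivity
      simp only [inner_add_left, inner_add_right, real_inner_smul_left, real_inner_smul_right,
        Nat.cast_ofNat, Nat.add_one_sub_one, pow_one]
      rw [real_inner_comm (ζ x) (∇ S x)]
      refine le_of_sub_nonneg (hnn.trans_eq ?_)
      linear_combination -(S x * 2 * ⟪ζ x, ∇ S x⟫
        + max (z x) 0 * ⟪∇ S x, ∇ S x⟫) * hmax)
  rw [hχ.integral_inner_gradient hG hS] at h2
  have h3 : ∫ x in G, V x * u x * φ x = ∫ x in G, V x * S x * χ x := by
    refine setIntegral_congr_fun hG.measurableSet fun x hx => ?_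
    have hmax : z x * max (z x) 0 ^ 2 = max (z x) 0 ^ 3 := by
      rcases le_total (z x) 0 with h | h
      · simp [max_eq_right h]
      · simp only [max_eq_left h]; ring
    simp only [huS x hx, hφdef, hχdef]
    linear_combination (V x * S x ^ 2) * hmax
  have hi1 : IntegrableOn (fun x => -Δ S x * χ x) G := by
    simpa using hχ.integrableOn_mul hG (continuousOn_laplacian hG hS).neg (MemH1Loc.const_one hG)
  have hi2 := hχ.integrableOn_mul hG hV hSH
  have h4 : ∫ x in G, (-Δ S x - V x * S x) * χ x ≤ 0 := by
    have : ∫ x in G, (-Δ S x - V x * S x) * χ x =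
        (∫ x in G, -Δ S x * χ x) - ∫ x in G, V x * S x * χ x := by
      rw [← integral_sub hi1 hi2]
      refine integral_congr_ae (Eventually.of_forall fun x => ?_)
      simp only; ring
    linarith
  have hnn : ∀ x ∈ G, 0 ≤ (-Δ S x - V x * S x) * χ x := fun x hx =>
    mul_nonneg (hLS x hx).le (mul_nonneg (hSpos x hx).le (by positivity))
  have hnn' : 0 ≤ᵐ[volume.restrict G] fun x => (-Δ S x - V x * S x) * χ x :=
    (ae_restrict_mem hG.measurableSet).mono hnn
  have hi : IntegrableOn (fun x => (-Δ S x - V x * S x) * χ x) G := by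
    refine (hi1.sub hi2).congr (Eventually.of_forall fun x => ?_)
    simp only [Pi.sub_apply]; ring
  have h5 := (setIntegral_eq_zero_iff_of_nonneg_ae hnn' hi).1
    (le_antisymm h4 (setIntegral_nonneg hG.measurableSet hnn))
  have hcont : ContinuousOn (fun x => (-Δ S x - V x * S x) * χ x) G :=
    ((continuousOn_laplacian hG hS).neg.sub (hV.mul hS.continuousOn)).mul
      (hS.continuousOn.mul ((hzc.sup continuousOn_const).pow 3))
  have h6 := Measure.eqOn_open_of_ae_eq h5 hG hcont continuousOn_const
  intro x hx
  have h7 : (-Δ S x - V x * S x) * (S x * max (z x) 0 ^ 3) = 0 := h6 hx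
  have h8 : max (z x) 0 = 0 := by
    simpa [(hLS x hx).ne', (hSpos x hx).ne'] using h7
  rw [huS x hx]
  exact mul_nonpos_of_nonneg_of_nonpos (hSpos x hx).le (max_eq_right_iff.1 h8)

end MaximumPrinciple

/-! ### Comparison with a decaying barrier -/

section Comparison

variable {Ω G : Set (EuclideanSpace ℝ (Fin N))} {μ : ℝ} {h : EuclideanSpace ℝ (Fin N) → ℝ}

theorem continuousOn_potential (hN : 2 ≤ N) (hΩ : IsBoundedSmoothDomain Ω) (μ : ℝ) :
    ContinuousOn (fun x => μ / bdryDist Ω x ^ 2) Ω :=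
  continuousOn_const.div ((continuous_bdryDist Ω).pow 2).continuousOn
    fun _ hx => pow_ne_zero 2 (hΩ.bdryDist_pos hN hx).ne'

theorem weakForm_indicator {G' : Set (EuclideanSpace ℝ (Fin N))} (hG' : IsOpen G') (hsub : G' ⊆ G)
    (g : EuclideanSpace ℝ (Fin N) → EuclideanSpace ℝ (Fin N)) (φ : EuclideanSpace ℝ (Fin N) → ℝ)
    (ψ : EuclideanSpace ℝ (Fin N) → EuclideanSpace ℝ (Fin N)) :
    weakForm Ω μ G h g (G'.indicator φ) (G'.indicator ψ) = weakForm Ω μ G' h g φ ψ := by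
  have e1 : (fun x => ⟪g x, G'.indicator ψ x⟫) = G'.indicator fun x => ⟪g x, ψ x⟫ := by
    ext x
    by_cases hx : x ∈ G' <;> simp [hx]
  have e2 : (fun x => μ / bdryDist Ω x ^ 2 * h x * G'.indicator φ x) =
      G'.indicator fun x => μ / bdryDist Ω x ^ 2 * h x * φ x := by
    ext x
    by_cases hx : x ∈ G' <;> simp [hx]
  rw [weakForm, weakForm, e1, e2, setIntegral_indicator hG'.measurableSet,
    setIntegral_indicator hG'.measurableSet, inter_eq_right.2 hsub]

theorem ae_indicator_nonneg {G' : Set (EuclideanSpace ℝ (Fin N))} (hG' : IsOpen G')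
    {φ : EuclideanSpace ℝ (Fin N) → ℝ} (hφ : ∀ᵐ x ∂(volume.restrict G'), 0 ≤ φ x) :
    ∀ᵐ x ∂(volume.restrict G), 0 ≤ G'.indicator φ x := by
  rw [ae_restrict_iff' hG'.measurableSet] at hφ
  exact ae_restrict_of_ae (hφ.mono fun x hx => by
    by_cases h : x ∈ G' <;> simp [h, hx])

theorem IsSubharmonicIn.mono {G' : Set (EuclideanSpace ℝ (Fin N))} (hG : IsOpen G)
    (hG' : IsOpen G') (hsub : G' ⊆ G) (hh : IsSubharmonicIn Ω μ G h) :
    IsSubharmonicIn Ω μ G' h := by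
  obtain ⟨hc, g, hg, hw⟩ := hh
  refine ⟨hc.mono hsub, g, hg.mono hG' hsub, fun φ ψ hφ h0 => ?_⟩
  rw [← weakForm_indicator hG' hsub]
  exact hw _ _ (hφ.indicator hG hG' hsub) (ae_indicator_nonneg hG' h0)

theorem IsSuperharmonicIn.mono {G' : Set (EuclideanSpace ℝ (Fin N))} (hG : IsOpen G)
    (hG' : IsOpen G') (hsub : G' ⊆ G) (hh : IsSuperharmonicIn Ω μ G h) :
    IsSuperharmonicIn Ω μ G' h := by
  obtain ⟨hc, g, hg, hw⟩ := hh
  refine ⟨hc.mono hsub, g, hg.mono hG' hsub, fun φ ψ hφ h0 => ?_⟩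
  rw [← weakForm_indicator hG' hsub]
  exact hw _ _ (hφ.indicator hG hG' hsub) (ae_indicator_nonneg hG' h0)

theorem weakForm_of_contDiffOn (hN : 2 ≤ N) (hΩ : IsBoundedSmoothDomain Ω) (hG : IsOpen G)
    (hGΩ : G ⊆ Ω) {S : EuclideanSpace ℝ (Fin N) → ℝ} (hS : ContDiffOn ℝ ∞ S G)
    {φ : EuclideanSpace ℝ (Fin N) → ℝ} {ψ : EuclideanSpace ℝ (Fin N) → EuclideanSpace ℝ (Fin N)}
    (hφ : MemH1Compact G φ ψ) :
    weakForm Ω μ G S (∇ S) φ ψ =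
      ∫ x in G, (-Δ S x - μ / bdryDist Ω x ^ 2 * S x) * φ x := by
  have hi1 : IntegrableOn (fun x => -Δ S x * φ x) G := by
    simpa using hφ.integrableOn_mul hG (continuousOn_laplacian hG hS).neg (MemH1Loc.const_one hG)
  have hi2 := hφ.integrableOn_mul hG ((continuousOn_potential hN hΩ μ).mono hGΩ)
    (MemH1Loc.of_contDiffOn hG hS)
  rw [weakForm, hφ.integral_inner_gradient hG hS, ← integral_sub hi1 hi2]
  refine integral_congr_ae (Eventually.of_forall fun x => ?_)
  simp only; ring

theorem isSuperharmonicIn_of_contDiffOn (hN : 2 ≤ N) (hΩ : IsBoundedSmoothDomain Ω)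
    (hG : IsOpen G) (hGΩ : G ⊆ Ω) {S : EuclideanSpace ℝ (Fin N) → ℝ} (hS : ContDiffOn ℝ ∞ S G)
    (hLS : ∀ x ∈ G, 0 ≤ -Δ S x - μ / bdryDist Ω x ^ 2 * S x) : IsSuperharmonicIn Ω μ G S := by
  refine ⟨hS.continuousOn, ∇ S, MemH1Loc.of_contDiffOn hG hS, fun φ ψ hφ h0 => ?_⟩
  rw [weakForm_of_contDiffOn hN hΩ hG hGΩ hS hφ]
  refine integral_nonneg_of_ae ?_
  filter_upwards [h0, ae_restrict_mem hG.measurableSet] with x hx hxG using mul_nonneg (hLS x hxG) hx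

theorem isSubharmonicIn_of_contDiffOn (hN : 2 ≤ N) (hΩ : IsBoundedSmoothDomain Ω)
    (hG : IsOpen G) (hGΩ : G ⊆ Ω) {S : EuclideanSpace ℝ (Fin N) → ℝ} (hS : ContDiffOn ℝ ∞ S G)
    (hLS : ∀ x ∈ G, -Δ S x - μ / bdryDist Ω x ^ 2 * S x ≤ 0) : IsSubharmonicIn Ω μ G S := by
  refine ⟨hS.continuousOn, ∇ S, MemH1Loc.of_contDiffOn hG hS, fun φ ψ hφ h0 => ?_⟩
  rw [weakForm_of_contDiffOn hN hΩ hG hGΩ hS hφ]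
  refine integral_nonpos_of_ae ?_
  filter_upwards [h0, ae_restrict_mem hG.measurableSet] with x hx hxG
  exact mul_nonpos_of_nonpos_of_nonneg (hLS x hxG) hx

theorem bdryStrip_mono {ρ ρ' : ℝ} (hρ : ρ ≤ ρ') : bdryStrip Ω ρ ⊆ bdryStrip Ω ρ' :=
  fun _ hx => ⟨hx.1, hx.2.trans_le hρ⟩

/-- Phragmén–Lindelöf principle: a sub-harmonic that is not large, as witnessed by the positive
super-harmonic `k`, is dominated by every smooth positive strict super-harmonic `S`. On a level set
of the distance `h ≤ C S`, near the boundary `h ≤ ε k`, so `h ≤ C S + ε k` in between by the maximum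
principle, and `ε` is arbitrary. -/
theorem exists_le_mul_barrier (hN : 2 ≤ N) (hΩ : IsBoundedSmoothDomain Ω)
    (hh : IsLocalSubharmonic Ω μ h) {k : EuclideanSpace ℝ (Fin N) → ℝ}
    (hk : IsPositiveLocalSuperharmonic Ω μ k) (hlim : limsupRatio Ω h k ≤ 0)
    {S : EuclideanSpace ℝ (Fin N) → ℝ} {ρ₀ : ℝ} (hρ₀ : 0 < ρ₀)
    (hS : ContDiffOn ℝ ∞ S (bdryStrip Ω ρ₀)) (hSpos : ∀ x ∈ bdryStrip Ω ρ₀, 0 < S x)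
    (hLS : ∀ x ∈ bdryStrip Ω ρ₀, 0 < -Δ S x - μ / bdryDist Ω x ^ 2 * S x) :
    ∃ C ≥ 0, ∃ ρ > 0, ∀ x ∈ bdryStrip Ω ρ, h x ≤ C * S x := by
  obtain ⟨ρ₁, hρ₁, hh⟩ := hh
  obtain ⟨ρ₂, hρ₂, hk, hkpos⟩ := hk
  set R := min ρ₀ (min ρ₁ ρ₂) with hR
  have hR0 : 0 < R := by positivity
  have hRρ₀ : R ≤ ρ₀ := min_le_left _ _
  have hRρ₁ : R ≤ ρ₁ := (min_le_right _ _).trans (min_le_left _ _)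
  have hRρ₂ : R ≤ ρ₂ := (min_le_right _ _).trans (min_le_right _ _)
  set ρ := R / 2 with hρ
  have hρ0 : 0 < ρ := by positivity
  have hρR : ρ < R := half_lt_self hR0
  have hGo : IsOpen (bdryStrip Ω ρ) := hΩ.isOpen_bdryStrip ρ
  have hshell : ∀ r, {x ∈ Ω | r ≤ bdryDist Ω x ∧ bdryDist Ω x ≤ ρ} ⊆ bdryStrip Ω R :=
    fun r x hx => ⟨hx.1, hx.2.2.trans_lt hρR⟩
  have hhc : ContinuousOn h (bdryStrip Ω R) := hh.1.mono (bdryStrip_mono hRρ₁)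
  have hkc : ContinuousOn k (bdryStrip Ω R) := hk.1.mono (bdryStrip_mono hRρ₂)
  have hSc : ContinuousOn S (bdryStrip Ω R) := hS.continuousOn.mono (bdryStrip_mono hRρ₀)
  have hSR : ∀ x ∈ bdryStrip Ω R, 0 < S x := fun x hx => hSpos x (bdryStrip_mono hRρ₀ hx)
  have hkR : ∀ x ∈ bdryStrip Ω R, 0 < k x := fun x hx => hkpos x (bdryStrip_mono hRρ₂ hx)
  obtain ⟨C₀, hC₀⟩ := (hΩ.isCompact_bdryDist_Icc hρ0 ρ).exists_bound_of_continuousOn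
    ((hhc.div hSc fun x hx => (hSR x hx).ne').mono (hshell ρ))
  set C := max C₀ 0 with hC
  refine ⟨C, le_max_right _ _, ρ, hρ0, ?_⟩
  have hsub := hh.mono (hΩ.isOpen_bdryStrip ρ₁) hGo (bdryStrip_mono (hρR.le.trans hRρ₁))
  have hsup := hk.mono (hΩ.isOpen_bdryStrip ρ₂) hGo (bdryStrip_mono (hρR.le.trans hRρ₂))
  have hS' := hS.mono (bdryStrip_mono (Ω := Ω) (hρR.le.trans hRρ₀))
  have hLS' : ∀ x ∈ bdryStrip Ω ρ, 0 < -Δ S x - μ / bdryDist Ω x ^ 2 * S x := fun x hx =>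
    hLS x (bdryStrip_mono (hρR.le.trans hRρ₀) hx)
  obtain ⟨-, gh, hgh, hwh⟩ := hsub
  obtain ⟨-, gk, hgk, hwk⟩ := hsup
  obtain ⟨-, gS, hgS, hwS⟩ := isSuperharmonicIn_of_contDiffOn hN hΩ hGo (fun x hx => hx.1) hS'
    fun x hx => (hLS' x hx).le
  have hV := (continuousOn_potential hN hΩ μ).mono (fun x hx => hx.1 : bdryStrip Ω ρ ⊆ Ω)
  have key : ∀ ε > 0, ∀ x ∈ bdryStrip Ω ρ, h x + (-ε) * k x + (-C) * S x ≤ 0 := by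
    intro ε hε
    obtain ⟨r, hr, hrlt⟩ := (hasBasis_toBdry Ω).eventually_iff.1
      (eventually_lt_of_limsup_lt (hlim.trans_lt (EReal.coe_pos.2 hε)))
    set u := fun x => h x + (-ε) * k x + (-C) * S x with hu
    have huc : ContinuousOn u (bdryStrip Ω R) :=
      (hhc.add (continuousOn_const.mul hkc)).add (continuousOn_const.mul hSc)
    have hpre := (huc.mono (hshell r)).preimage_isClosed_of_isClosed
      (hΩ.isCompact_bdryDist_Icc hr ρ).isClosed isClosed_Ici (t := Ici 0)
    refine nonpos_of_subsolution hGo hV hS' (fun x hx => hSR x (bdryStrip_mono hρR.le hx)) hLS'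
      (huc.mono (bdryStrip_mono hρR.le))
      ((hgh.add hGo (hgk.const_mul hGo (-ε))).add hGo (hgS.const_mul hGo (-C)))
      (fun φ ψ hφ h0 => ?_) (K := {x ∈ Ω | r ≤ bdryDist Ω x ∧ bdryDist Ω x ≤ ρ} ∩ u ⁻¹' Ici 0)
      ?_ ((hΩ.isCompact_bdryDist_Icc hr ρ).of_isClosed_subset hpre inter_subset_left) ?_
    · have a1 := hwh φ ψ hφ h0
      have a2 := hwk φ ψ hφ h0
      have a3 := hwS φ ψ hφ h0
      have e1 : ∫ x in bdryStrip Ω ρ, ⟪gh x + (-ε) • gk x + (-C) • gS x, ψ x⟫ =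
          (∫ x in bdryStrip Ω ρ, ⟪gh x, ψ x⟫) + (-ε) * (∫ x in bdryStrip Ω ρ, ⟪gk x, ψ x⟫) +
            (-C) * ∫ x in bdryStrip Ω ρ, ⟪gS x, ψ x⟫ := by
        have i1 := hφ.integrableOn_inner hGo hgh
        have i2 := (hφ.integrableOn_inner hGo hgk).const_mul (-ε)
        have i3 := (hφ.integrableOn_inner hGo hgS).const_mul (-C)
        simp only [inner_add_left, real_inner_smul_left]
        rw [integral_add (f := fun x => ⟪gh x, ψ x⟫ + -ε * ⟪gk x, ψ x⟫) (i1.add i2) i3,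
          integral_add i1 i2, integral_const_mul,
          integral_const_mul]
      have e2 : ∫ x in bdryStrip Ω ρ, μ / bdryDist Ω x ^ 2 * u x * φ x =
          (∫ x in bdryStrip Ω ρ, μ / bdryDist Ω x ^ 2 * h x * φ x) +
          (-ε) * (∫ x in bdryStrip Ω ρ, μ / bdryDist Ω x ^ 2 * k x * φ x) +
            (-C) * ∫ x in bdryStrip Ω ρ, μ / bdryDist Ω x ^ 2 * S x * φ x := by
        have i1 := hφ.integrableOn_mul hGo hV hgh
        have i2 := (hφ.integrableOn_mul hGo hV hgk).const_mul (-ε)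
        have i3 := (hφ.integrableOn_mul hGo hV hgS).const_mul (-C)
        rw [← integral_const_mul, ← integral_const_mul, ← integral_add i1 i2,
          ← integral_add (f := fun x => μ / bdryDist Ω x ^ 2 * h x * φ x +
            -ε * (μ / bdryDist Ω x ^ 2 * k x * φ x)) (Integrable.add i1 i2) i3]
        refine integral_congr_ae (Eventually.of_forall fun x => ?_)
        simp only [hu]; ring
      rw [weakForm] at a1 a2 a3
      rw [e1, e2]
      have b2 := mul_nonneg hε.le a2
      have b3 := mul_nonneg (le_max_right C₀ 0) a3
      linarith
    · rintro x ⟨hx, hux⟩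
      refine ⟨hx.1, lt_of_le_of_ne hx.2.2 fun heq => ?_⟩
      have hxR := hshell r hx
      have h1 := (le_abs_self _).trans (hC₀ x ⟨hx.1, heq.ge, heq.le⟩)
      have h2 : h x ≤ C * S x := by
        rw [Pi.div_apply, div_le_iff₀ (hSR x hxR)] at h1
        exact h1.trans (mul_le_mul_of_nonneg_right (le_max_left _ _) (hSR x hxR).le)
      have h3 : 0 ≤ h x + (-ε) * k x + (-C) * S x := hux
      have h4 := mul_pos hε (hkR x hxR)
      linarith
    · intro x hx hxK
      have hxR := bdryStrip_mono hρR.le hx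
      rcases le_or_gt r (bdryDist Ω x) with hxr | hxr
      · exact (not_le.1 fun h0 => hxK ⟨⟨hx.1, hxr, hx.2.le⟩, h0⟩).le
      · have h1 := EReal.coe_lt_coe_iff.1 (hrlt ⟨hx.1, hxr⟩)
        rw [div_lt_iff₀ (hkR x hxR)] at h1
        have h2 := mul_nonneg (le_max_right C₀ 0) (hSR x hxR).le
        have h3 : u x = h x - ε * k x - C * S x := by simp only [hu]; ring
        exact (by linarith : u x ≤ 0)
  intro x hx
  refine le_of_forall_pos_le_add fun e he => ?_
  have hkx := hkR x (bdryStrip_mono hρR.le hx)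
  have := key (e / k x) (div_pos he hkx) x hx
  rw [neg_mul, div_mul_cancel₀ _ hkx.ne'] at this
  linarith

end Comparison

/-! ### Barriers depending on the distance only -/

theorem laplacian_comp {d : EuclideanSpace ℝ (Fin N) → ℝ} {x : EuclideanSpace ℝ (Fin N)}
    (hd : ContDiffAt ℝ ∞ d x) {f f' f'' : ℝ → ℝ} (hf : ContDiffAt ℝ ∞ f (d x))
    (hf' : ∀ᶠ t in 𝓝 (d x), HasDerivAt f (f' t) t) (hf'' : HasDerivAt f' (f'' (d x)) (d x)) :
    Δ (fun y => f (d y)) x = f'' (d x) * ‖∇ d x‖ ^ 2 + f' (d x) * Δ d x := by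
  have h2 : (2 : ℕ∞ω) ≤ ∞ := WithTop.coe_le_coe.2 le_top
  have hcomp : ContDiffAt ℝ ∞ (fun y => f (d y)) x := hf.comp x hd
  rw [laplacian_eq_sum_fderiv (hcomp.of_le h2), laplacian_eq_sum_fderiv (hd.of_le h2)]
  have hnorm : ‖∇ d x‖ ^ 2 = ∑ i : Fin N, fderiv ℝ d x (EuclideanSpace.single i 1) ^ 2 := by
    rw [← (EuclideanSpace.basisFun (Fin N) ℝ).sum_sq_norm_inner_left (∇ d x)]
    refine Finset.sum_congr rfl fun i _ => ?_
    rw [EuclideanSpace.basisFun_apply, inner_gradient_left, Real.norm_eq_abs, sq_abs]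
  have hdiff : ∀ᶠ y in 𝓝 x, DifferentiableAt ℝ d y := by
    have := (hd.of_le (m := 1) (WithTop.coe_le_coe.2 le_top)).eventually (by simp)
    exact this.mono fun y hy => hy.differentiableAt (by simp)
  rw [hnorm, Finset.mul_sum, Finset.mul_sum, ← Finset.sum_add_distrib]
  refine Finset.sum_congr rfl fun i _ => ?_
  set e : EuclideanSpace ℝ (Fin N) := EuclideanSpace.single i 1
  have h1 : (fun y => fderiv ℝ (fun y => f (d y)) y e) =ᶠ[𝓝 x]
      fun y => f' (d y) * fderiv ℝ d y e := by
    filter_upwards [hdiff, hd.continuousAt.eventually hf'] with y hy hfy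
    have : HasFDerivAt (fun y => f (d y)) _ y := hfy.comp_hasFDerivAt y hy.hasFDerivAt
    rw [this.fderiv]
    simp
  have h3 : HasFDerivAt (fun y => f' (d y)) _ x :=
    hf''.comp_hasFDerivAt x (hd.differentiableAt (by simp)).hasFDerivAt
  have h4 := (contDiffAt_fderiv_apply hd e).differentiableAt (by simp)
  rw [h1.fderiv_eq, fderiv_fun_mul h3.differentiableAt h4, h3.fderiv]
  simp only [add_apply, smul_apply, smul_eq_mul]
  ring

/-- A solution `f`, positive near `0`, of the Euler equation `f'' + μ t⁻² f = 0`, with derivative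
`f'`, together with an exponent `b` such that `t ^ b` is of lower order than `f` and does not
solve the equation. Adding a multiple of `t ^ b` to `f` then produces strict sub- and
super-solutions, because `f' = o(t ^ (b - 2))` makes the curvature terms negligible. -/
structure IsEulerProfile (μ : ℝ) (f f' : ℝ → ℝ) (b : ℝ) : Prop where
  contDiffOn : ContDiffOn ℝ ∞ f (Ioi 0)
  hasDerivAt : ∀ t > 0, HasDerivAt f (f' t) t
  hasDerivAt_deriv : ∀ t > 0, HasDerivAt f' (-(μ / t ^ 2 * f t)) t
  pos : ∀ᶠ t in 𝓝[>] 0, 0 < f t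
  exponent_ne : b * (b - 1) + μ ≠ 0
  tendsto_deriv : Tendsto (fun t => t ^ (2 - b) * f' t) (𝓝[>] 0) (𝓝 0)
  tendsto_rpow_div : Tendsto (fun t => t ^ b / f t) (𝓝[>] 0) (𝓝 0)

/-- The function `f(δ) + c δ ^ b`. -/
def barrier (Ω : Set (EuclideanSpace ℝ (Fin N))) (f : ℝ → ℝ) (b c : ℝ)
    (x : EuclideanSpace ℝ (Fin N)) : ℝ :=
  f (bdryDist Ω x) + c * bdryDist Ω x ^ b

namespace IsEulerProfile

variable {Ω : Set (EuclideanSpace ℝ (Fin N))} {μ : ℝ} {f f' : ℝ → ℝ} {b : ℝ}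

theorem tendsto_perturbed_div (hf : IsEulerProfile μ f f' b) (c : ℝ) :
    Tendsto (fun t => (f t + c * t ^ b) / f t) (𝓝[>] 0) (𝓝 1) := by
  have h : Tendsto (fun t => 1 + c * (t ^ b / f t)) (𝓝[>] 0) (𝓝 (1 + c * 0)) :=
    (hf.tendsto_rpow_div.const_mul c).const_add 1
  rw [mul_zero, add_zero] at h
  refine h.congr' ?_
  filter_upwards [hf.pos] with t ht
  field_simp

theorem tendsto_barrier_div (hN : 2 ≤ N) (hΩ : IsBoundedSmoothDomain Ω)
    (hf : IsEulerProfile μ f f' b) (c : ℝ) :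
    Tendsto (fun x => barrier Ω f b c x / f (bdryDist Ω x)) (toBdry Ω) (𝓝 1) :=
  (hf.tendsto_perturbed_div c).comp (tendsto_bdryDist_toBdry hN hΩ)

theorem eventually_pos_toBdry (hN : 2 ≤ N) (hΩ : IsBoundedSmoothDomain Ω)
    (hf : IsEulerProfile μ f f' b) : ∀ᶠ x in toBdry Ω, 0 < f (bdryDist Ω x) :=
  (tendsto_bdryDist_toBdry hN hΩ).eventually hf.pos

theorem exists_strip_barrier (hN : 2 ≤ N) (hΩ : IsBoundedSmoothDomain Ω)
    (hf : IsEulerProfile μ f f' b) (c : ℝ) :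
    ∃ ρ > 0, ContDiffOn ℝ ∞ (barrier Ω f b c) (bdryStrip Ω ρ) ∧
      ∀ x ∈ bdryStrip Ω ρ, 0 < barrier Ω f b c x ∧
        |Δ (barrier Ω f b c) x + μ / bdryDist Ω x ^ 2 * barrier Ω f b c x -
          c * (b * (b - 1) + μ) * bdryDist Ω x ^ (b - 2)| < bdryDist Ω x ^ (b - 2) := by
  obtain ⟨ρ₀, hρ₀, M, hM, hδ⟩ := hΩ.exists_strip_smooth hN
  have hpos : ∀ᶠ t in 𝓝[>] (0 : ℝ), 0 < f t + c * t ^ b := by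
    filter_upwards [hf.pos, (hf.tendsto_perturbed_div c).eventually_const_lt zero_lt_one]
      with t ht h
    exact (div_pos_iff_of_pos_right ht).1 h
  have hsmall : ∀ᶠ t in 𝓝[>] (0 : ℝ), |f' t + c * (b * t ^ (b - 1))| * M < t ^ (b - 2) := by
    have h1 : Tendsto (fun t : ℝ => |t ^ (2 - b) * f' t + c * b * t| * M) (𝓝[>] 0)
        (𝓝 (|0 + c * b * 0| * M)) :=
      ((hf.tendsto_deriv.add
        ((tendsto_id.mono_left nhdsWithin_le_nhds).const_mul (c * b))).abs).mul_const M
    rw [mul_zero, add_zero, abs_zero, zero_mul] at h1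
    filter_upwards [h1.eventually_lt_const zero_lt_one, self_mem_nhdsWithin] with t h2 ht
    have ht0 : (0 : ℝ) < t := ht
    have hp := Real.rpow_pos_of_pos ht0 (b - 2)
    have e1 : t ^ (b - 2) * t ^ (2 - b) = 1 := by
      rw [← Real.rpow_add ht0]; simp
    have e2 : t ^ (b - 1) = t ^ (b - 2) * t := by
      rw [← Real.rpow_add_one ht0.ne']; ring_nf
    have e3 : f' t + c * (b * t ^ (b - 1)) =
        t ^ (b - 2) * (t ^ (2 - b) * f' t + c * b * t) := by
      rw [e2]; linear_combination -(f' t) * e1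
    rw [e3, abs_mul, abs_of_pos hp, mul_assoc]
    exact mul_lt_of_lt_one_right hp h2
  obtain ⟨ρ₁, hρ₁, hsub⟩ := (hasBasis_toBdry Ω).eventually_iff.1
    ((tendsto_bdryDist_toBdry hN hΩ).eventually (hpos.and hsmall))
  have key : ∀ x ∈ bdryStrip Ω (min ρ₀ ρ₁), ContDiffAt ℝ ∞ (barrier Ω f b c) x ∧
      Δ (barrier Ω f b c) x = -(μ / bdryDist Ω x ^ 2 * f (bdryDist Ω x)) +
        c * (b * ((b - 1) * bdryDist Ω x ^ (b - 2))) +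
        (f' (bdryDist Ω x) + c * (b * bdryDist Ω x ^ (b - 1))) * Δ (bdryDist Ω) x := by
    intro x hx
    have ht := hΩ.bdryDist_pos hN hx.1
    obtain ⟨hC, hg, -⟩ := hδ x (bdryStrip_mono (min_le_left _ _) hx)
    have hF : ContDiffAt ℝ ∞ (fun t => f t + c * t ^ b) (bdryDist Ω x) :=
      (hf.contDiffOn.contDiffAt (Ioi_mem_nhds ht)).add
        (contDiffAt_const.mul (Real.contDiffAt_rpow_const_of_ne ht.ne'))
    refine ⟨hF.comp x hC, ?_⟩
    have h1 : ∀ᶠ t in 𝓝 (bdryDist Ω x),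
        HasDerivAt (fun t => f t + c * t ^ b) (f' t + c * (b * t ^ (b - 1))) t := by
      filter_upwards [Ioi_mem_nhds ht] with t ht'
      exact (hf.hasDerivAt t ht').add
        ((Real.hasDerivAt_rpow_const (Or.inl (ne_of_gt ht'))).const_mul c)
    have h2 : HasDerivAt (fun t => f' t + c * (b * t ^ (b - 1)))
        (-(μ / bdryDist Ω x ^ 2 * f (bdryDist Ω x)) +
          c * (b * ((b - 1) * bdryDist Ω x ^ (b - 2)))) (bdryDist Ω x) := by
      have h3 := Real.hasDerivAt_rpow_const (x := bdryDist Ω x) (p := b - 1) (Or.inl ht.ne')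
      rw [show b - 1 - 1 = b - 2 by ring] at h3
      exact (hf.hasDerivAt_deriv _ ht).add ((h3.const_mul b).const_mul c)
    have := laplacian_comp hC hF h1
      (f'' := fun t => -(μ / t ^ 2 * f t) + c * (b * ((b - 1) * t ^ (b - 2)))) h2
    rw [hg, one_pow, mul_one] at this
    exact this
  refine ⟨min ρ₀ ρ₁, lt_min hρ₀ hρ₁, fun x hx => (key x hx).1.contDiffWithinAt, fun x hx => ?_⟩
  obtain ⟨hp, hs⟩ := hsub (bdryStrip_mono (min_le_right _ _) hx)
  refine ⟨hp, ?_⟩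
  have ht := hΩ.bdryDist_pos hN hx.1
  have hL := (hδ x (bdryStrip_mono (min_le_left _ _) hx)).2.2
  have e1 : bdryDist Ω x ^ b = bdryDist Ω x ^ (b - 2) * bdryDist Ω x ^ 2 := by
    rw [← Real.rpow_natCast, ← Real.rpow_add ht]; norm_num
  have e2 : Δ (barrier Ω f b c) x + μ / bdryDist Ω x ^ 2 * barrier Ω f b c x -
      c * (b * (b - 1) + μ) * bdryDist Ω x ^ (b - 2) =
      (f' (bdryDist Ω x) + c * (b * bdryDist Ω x ^ (b - 1))) * Δ (bdryDist Ω) x := by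
    rw [(key x hx).2, barrier, e1]
    field_simp
    ring
  rw [e2, abs_mul]
  exact (mul_le_mul_of_nonneg_left hL (abs_nonneg _)).trans_lt hs

/-- For the right multiple of `δ ^ b` the barrier is a positive strict super-harmonic. -/
theorem exists_super (hN : 2 ≤ N) (hΩ : IsBoundedSmoothDomain Ω)
    (hf : IsEulerProfile μ f f' b) :
    ∃ S : EuclideanSpace ℝ (Fin N) → ℝ,
      Tendsto (fun x => S x / f (bdryDist Ω x)) (toBdry Ω) (𝓝 1) ∧
      ∃ ρ > 0, ContDiffOn ℝ ∞ S (bdryStrip Ω ρ) ∧ (∀ x ∈ bdryStrip Ω ρ, 0 < S x) ∧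
        ∀ x ∈ bdryStrip Ω ρ, 0 < -Δ S x - μ / bdryDist Ω x ^ 2 * S x := by
  set c := -(b * (b - 1) + μ)⁻¹ with hc
  have hcκ : c * (b * (b - 1) + μ) = -1 := by
    rw [hc, neg_mul, inv_mul_cancel₀ hf.exponent_ne]
  obtain ⟨ρ, hρ, hC, h⟩ := hf.exists_strip_barrier hN hΩ c
  refine ⟨barrier Ω f b c, hf.tendsto_barrier_div hN hΩ c, ρ, hρ, hC, fun x hx => (h x hx).1,
    fun x hx => ?_⟩
  have := (abs_lt.1 (h x hx).2).2
  rw [hcκ] at this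
  linarith

/-- For the opposite multiple of `δ ^ b` the barrier is a sub-harmonic. -/
theorem exists_sub (hN : 2 ≤ N) (hΩ : IsBoundedSmoothDomain Ω)
    (hf : IsEulerProfile μ f f' b) :
    ∃ S : EuclideanSpace ℝ (Fin N) → ℝ,
      Tendsto (fun x => S x / f (bdryDist Ω x)) (toBdry Ω) (𝓝 1) ∧ IsLocalSubharmonic Ω μ S := by
  set c := (b * (b - 1) + μ)⁻¹ with hc
  have hcκ : c * (b * (b - 1) + μ) = 1 := inv_mul_cancel₀ hf.exponent_ne
  obtain ⟨ρ, hρ, hC, h⟩ := hf.exists_strip_barrier hN hΩ c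
  refine ⟨barrier Ω f b c, hf.tendsto_barrier_div hN hΩ c, ρ, hρ,
    isSubharmonicIn_of_contDiffOn hN hΩ (hΩ.isOpen_bdryStrip ρ) (fun x hx => hx.1) hC
      fun x hx => ?_⟩
  have := (abs_lt.1 (h x hx).2).1
  rw [hcκ] at this
  linarith

end IsEulerProfile

/-! ### The dichotomy for a pair of profiles -/

section Dichotomy

variable {Ω : Set (EuclideanSpace ℝ (Fin N))} {μ : ℝ} {p p' q q' : ℝ → ℝ} {a b : ℝ}

theorem isPositiveLocalSuperharmonic_of_barrier (hN : 2 ≤ N) (hΩ : IsBoundedSmoothDomain Ω)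
    {S : EuclideanSpace ℝ (Fin N) → ℝ} {ρ : ℝ} (hρ : 0 < ρ)
    (hS : ContDiffOn ℝ ∞ S (bdryStrip Ω ρ)) (hSpos : ∀ x ∈ bdryStrip Ω ρ, 0 < S x)
    (hLS : ∀ x ∈ bdryStrip Ω ρ, 0 < -Δ S x - μ / bdryDist Ω x ^ 2 * S x) :
    IsPositiveLocalSuperharmonic Ω μ S :=
  ⟨ρ, hρ, isSuperharmonicIn_of_contDiffOn hN hΩ (hΩ.isOpen_bdryStrip ρ) (fun _ hx => hx.1) hS
    fun x hx => (hLS x hx).le, hSpos⟩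

/-- A sub-harmonic that some positive super-harmonic witnesses as not large is bounded by a multiple
of the profile near the boundary. -/
theorem exists_le_mul_profile (hN : 2 ≤ N) (hΩ : IsBoundedSmoothDomain Ω)
    (hp : IsEulerProfile μ p p' a) {h k : EuclideanSpace ℝ (Fin N) → ℝ}
    (hh : IsLocalSubharmonic Ω μ h) (hk : IsPositiveLocalSuperharmonic Ω μ k)
    (hlim : limsupRatio Ω h k ≤ 0) :
    ∃ C : ℝ, ∀ᶠ x in toBdry Ω, h x ≤ C * p (bdryDist Ω x) := by
  obtain ⟨S, hSp, ρ, hρ, hS, hSpos, hLS⟩ := hp.exists_super hN hΩ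
  obtain ⟨C, hC, ρ', hρ', hle⟩ := exists_le_mul_barrier hN hΩ hh hk hlim hρ hS hSpos hLS
  refine ⟨C * 2, ?_⟩
  filter_upwards [(hasBasis_toBdry Ω).mem_of_mem hρ', hp.eventually_pos_toBdry hN hΩ,
    hSp.eventually_lt_const one_lt_two] with x hx hpx hSx
  rw [div_lt_iff₀ hpx] at hSx
  rw [mul_assoc]
  exact (hle x hx).trans (mul_le_mul_of_nonneg_left hSx.le hC)

theorem limsupRatio_lt_top_of_isSmall (hN : 2 ≤ N) (hΩ : IsBoundedSmoothDomain Ω)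
    (hp : IsEulerProfile μ p p' a) {h : EuclideanSpace ℝ (Fin N) → ℝ}
    (hh : IsSmallSubharmonic Ω μ h) : limsupRatio Ω h (fun x => p (bdryDist Ω x)) < ⊤ := by
  obtain ⟨hsub, hnot⟩ := hh
  have : ∃ k, IsPositiveLocalSuperharmonic Ω μ k ∧ limsupRatio Ω h k ≤ 0 := by
    by_contra! hcon
    exact hnot ⟨hsub, hcon⟩
  obtain ⟨k, hk, hlim⟩ := this
  obtain ⟨C, hC⟩ := exists_le_mul_profile hN hΩ hp hsub hk hlim
  refine lt_of_le_of_lt (limsup_le_of_le (a := (C : EReal)) ?_ ?_) (EReal.coe_lt_top C)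
  · isBoundedDefault
  · filter_upwards [hC, hp.eventually_pos_toBdry hN hΩ] with x hx hpx
    exact EReal.coe_le_coe_iff.2 ((div_le_iff₀ hpx).2 hx)

theorem limsupRatio_pos_of_isLarge (hN : 2 ≤ N) (hΩ : IsBoundedSmoothDomain Ω)
    (hq : IsEulerProfile μ q q' b) {H : EuclideanSpace ℝ (Fin N) → ℝ}
    (hH : IsLargeSubharmonic Ω μ H) : 0 < limsupRatio Ω H (fun x => q (bdryDist Ω x)) := by
  obtain ⟨S, hSq, ρ, hρ, hS, hSpos, hLS⟩ := hq.exists_super hN hΩ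
  have hpos := hH.2 S (isPositiveLocalSuperharmonic_of_barrier hN hΩ hρ hS hSpos hLS)
  obtain ⟨c, hc0, hc⟩ := EReal.lt_iff_exists_real_btwn.1 hpos
  have hc0' : 0 < c := EReal.coe_pos.1 hc0
  have hfreq : ∃ᶠ x in toBdry Ω, (c : EReal) < ((H x / S x : ℝ) : EReal) :=
    frequently_lt_of_lt_limsup (by isBoundedDefault) hc
  have hstrip : ∀ᶠ x in toBdry Ω, x ∈ bdryStrip Ω ρ := (hasBasis_toBdry Ω).mem_of_mem hρ
  refine lt_of_lt_of_le (EReal.coe_pos.2 (half_pos hc0')) (le_limsup_of_frequently_le ?_ ?_)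
  · refine (hfreq.and_eventually (hstrip.and
      ((hq.eventually_pos_toBdry hN hΩ).and
        (hSq.eventually_const_lt one_half_lt_one)))).mono fun x hx => ?_
    obtain ⟨h1, h2, h3, h4⟩ := hx
    have hSx := hSpos x h2
    rw [EReal.coe_lt_coe_iff, lt_div_iff₀ hSx] at h1
    rw [lt_div_iff₀ h3] at h4
    rw [EReal.coe_le_coe_iff, le_div_iff₀ h3]
    nlinarith
  · isBoundedDefault

theorem limsupRatio_eq_zero (hN : 2 ≤ N) (hΩ : IsBoundedSmoothDomain Ω)
    {h k : EuclideanSpace ℝ (Fin N) → ℝ}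
    (hlim : Tendsto (fun x => h x / k x) (toBdry Ω) (𝓝 0)) : limsupRatio Ω h k = 0 := by
  have := toBdry_neBot hN hΩ
  exact ((continuous_coe_real_ereal.tendsto 0).comp hlim).limsup_eq

theorem exists_isSmall_asymptotic (hN : 2 ≤ N) (hΩ : IsBoundedSmoothDomain Ω)
    (hp : IsEulerProfile μ p p' a) (hq : IsEulerProfile μ q q' b)
    (hpq : Tendsto (fun t => p t / q t) (𝓝[>] 0) (𝓝 0)) :
    ∃ h, IsSmallSubharmonic Ω μ h ∧
      Tendsto (fun x => h x / p (bdryDist Ω x)) (toBdry Ω) (𝓝 1) := by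
  obtain ⟨h, hhp, hsub⟩ := hp.exists_sub hN hΩ
  obtain ⟨S, hSq, ρ, hρ, hS, hSpos, hLS⟩ := hq.exists_super hN hΩ
  refine ⟨h, ⟨hsub, fun hlarge => ?_⟩, hhp⟩
  have hpos := hlarge.2 S (isPositiveLocalSuperharmonic_of_barrier hN hΩ hρ hS hSpos hLS)
  refine hpos.ne' (limsupRatio_eq_zero hN hΩ ?_)
  have h1 := (hhp.mul (hpq.comp (tendsto_bdryDist_toBdry hN hΩ))).div hSq one_ne_zero
  rw [mul_zero, zero_div] at h1
  refine h1.congr' ?_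
  filter_upwards [hp.eventually_pos_toBdry hN hΩ, hq.eventually_pos_toBdry hN hΩ,
    (hasBasis_toBdry Ω).mem_of_mem hρ] with x hpx hqx hx
  have hSx := hSpos x hx
  simp only [Function.comp, Pi.div_apply]
  field_simp

theorem exists_isLarge_asymptotic (hN : 2 ≤ N) (hΩ : IsBoundedSmoothDomain Ω)
    (hp : IsEulerProfile μ p p' a) (hq : IsEulerProfile μ q q' b)
    (hpq : Tendsto (fun t => p t / q t) (𝓝[>] 0) (𝓝 0)) :
    ∃ H, IsLargeSubharmonic Ω μ H ∧
      Tendsto (fun x => H x / q (bdryDist Ω x)) (toBdry Ω) (𝓝 1) := by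
  obtain ⟨H, hHq, hsub⟩ := hq.exists_sub hN hΩ
  refine ⟨H, ⟨hsub, fun k hk => not_le.1 fun hlim => ?_⟩, hHq⟩
  obtain ⟨C, hC⟩ := exists_le_mul_profile hN hΩ hp hsub hk hlim
  have := toBdry_neBot hN hΩ
  -- otherwise `H / q ≤ C p / q → 0`, contradicting `H / q → 1`
  have h1 := (hpq.comp (tendsto_bdryDist_toBdry hN hΩ)).const_mul C
  rw [mul_zero] at h1
  refine absurd (le_of_tendsto_of_tendsto hHq h1 ?_) (not_le.2 zero_lt_one)
  filter_upwards [hC, hq.eventually_pos_toBdry hN hΩ] with x hx hqx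
  simp only [Function.comp]
  rw [div_le_iff₀ hqx, mul_assoc, div_mul_cancel₀ _ hqx.ne']
  exact hx

/-- Both orders of decay, and their sharpness, for a pair of profiles with `p = o(q)`. -/
theorem dichotomy_of_profiles (hN : 2 ≤ N) (hΩ : IsBoundedSmoothDomain Ω)
    (hp : IsEulerProfile μ p p' a) (hq : IsEulerProfile μ q q' b)
    (hpq : Tendsto (fun t => p t / q t) (𝓝[>] 0) (𝓝 0)) :
    (∀ h, IsSmallSubharmonic Ω μ h → limsupRatio Ω h (fun x => p (bdryDist Ω x)) < ⊤) ∧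
    (∀ H, IsLargeSubharmonic Ω μ H → 0 < limsupRatio Ω H (fun x => q (bdryDist Ω x))) ∧
    (∃ h, IsSmallSubharmonic Ω μ h ∧
      Tendsto (fun x => h x / p (bdryDist Ω x)) (toBdry Ω) (𝓝 1)) ∧
    (∃ H, IsLargeSubharmonic Ω μ H ∧
      Tendsto (fun x => H x / q (bdryDist Ω x)) (toBdry Ω) (𝓝 1)) :=
  ⟨fun _ => limsupRatio_lt_top_of_isSmall hN hΩ hp, fun _ => limsupRatio_pos_of_isLarge hN hΩ hq,
    exists_isSmall_asymptotic hN hΩ hp hq hpq, exists_isLarge_asymptotic hN hΩ hp hq hpq⟩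

end Dichotomy

/-! ### The power and logarithmic profiles -/

theorem tendsto_rpow_nhdsGT_zero {r : ℝ} (hr : 0 < r) :
    Tendsto (fun t : ℝ => t ^ r) (𝓝[>] 0) (𝓝 0) := by
  have := (Real.continuousAt_rpow_const 0 r (Or.inr hr.le)).tendsto
  rw [Real.zero_rpow hr.ne'] at this
  exact this.mono_left nhdsWithin_le_nhds

theorem isEulerProfile_rpow {μ β e : ℝ} (hβ : β * (β - 1) + μ = 0) (he : 0 < e) (he1 : e < 1)
    (hne : e * (2 * β - 1 + e) ≠ 0) :
    IsEulerProfile μ (fun t => t ^ β) (fun t => β * t ^ (β - 1)) (β + e) where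
  contDiffOn _ ht := (Real.contDiffAt_rpow_const_of_ne (ne_of_gt ht)).contDiffWithinAt
  hasDerivAt _ ht := Real.hasDerivAt_rpow_const (Or.inl (ne_of_gt ht))
  hasDerivAt_deriv t ht := by
    have h := (Real.hasDerivAt_rpow_const (x := t) (p := β - 1) (Or.inl (ne_of_gt ht))).const_mul β
    refine h.congr_deriv ?_
    have e1 : t ^ β = t ^ (β - 1 - 1) * t ^ 2 := by
      rw [← Real.rpow_natCast, ← Real.rpow_add ht]; congr 1; push_cast; ring
    rw [e1, show μ = -(β * (β - 1)) by linarith]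
    field_simp
  pos := by
    filter_upwards [self_mem_nhdsWithin] with t ht using Real.rpow_pos_of_pos ht β
  exponent_ne h := hne (by linear_combination h - hβ)
  tendsto_deriv := by
    have h := (tendsto_rpow_nhdsGT_zero (sub_pos.2 he1)).const_mul β
    rw [mul_zero] at h
    refine h.congr' ?_
    filter_upwards [self_mem_nhdsWithin] with t ht
    rw [mul_left_comm, ← Real.rpow_add ht]
    ring_nf
  tendsto_rpow_div := by
    refine (tendsto_rpow_nhdsGT_zero he).congr' ?_
    filter_upwards [self_mem_nhdsWithin] with t ht
    rw [← Real.rpow_sub ht]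
    ring_nf

theorem tendsto_log_one_div_atTop : Tendsto (fun t : ℝ => Real.log (1 / t)) (𝓝[>] 0) atTop := by
  simp only [one_div]
  exact Real.tendsto_log_atTop.comp tendsto_inv_nhdsGT_zero

theorem isEulerProfile_sqrt_log :
    IsEulerProfile (1 / 4) (fun t => t ^ (1 / 2 : ℝ) * Real.log (1 / t))
      (fun t => t ^ (-1 / 2 : ℝ) * (Real.log (1 / t) / 2 - 1)) 1 where
  contDiffOn t ht := by
    have h1 : ContDiffAt ℝ ∞ (fun t : ℝ => 1 / t) t :=
      contDiffAt_const.div contDiffAt_id (ne_of_gt ht)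
    have h2 : (1 : ℝ) / t ≠ 0 := one_div_ne_zero (ne_of_gt ht)
    exact ((Real.contDiffAt_rpow_const_of_ne (ne_of_gt ht)).mul (h1.log h2)).contDiffWithinAt
  hasDerivAt t ht := by
    have hl : HasDerivAt (fun t : ℝ => Real.log (1 / t)) (-t⁻¹) t := by
      simpa only [one_div, Real.log_inv] using (Real.hasDerivAt_log (ne_of_gt ht)).fun_neg
    have h := (Real.hasDerivAt_rpow_const (x := t) (p := 1 / 2) (Or.inl (ne_of_gt ht))).fun_mul hl
    refine h.congr_deriv ?_
    have e1 : t ^ (1 / 2 : ℝ) = t ^ (-1 / 2 : ℝ) * t := by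
      rw [← Real.rpow_add_one (ne_of_gt ht)]; norm_num
    have ht' : t ≠ 0 := ne_of_gt ht
    rw [show (1 / 2 - 1 : ℝ) = -1 / 2 by norm_num, e1]
    field_simp
    ring
  hasDerivAt_deriv t ht := by
    have hl : HasDerivAt (fun t : ℝ => Real.log (1 / t)) (-t⁻¹) t := by
      simpa only [one_div, Real.log_inv] using (Real.hasDerivAt_log (ne_of_gt ht)).fun_neg
    have h := (Real.hasDerivAt_rpow_const (x := t) (p := -1 / 2) (Or.inl (ne_of_gt ht))).fun_mul
      ((hl.div_const 2).sub_const 1)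
    refine h.congr_deriv ?_
    have e1 : t ^ (-1 / 2 : ℝ) = t ^ (-1 / 2 - 1 : ℝ) * t := by
      rw [← Real.rpow_add_one (ne_of_gt ht)]; norm_num
    have e2 : t ^ (1 / 2 : ℝ) = t ^ (-1 / 2 - 1 : ℝ) * t ^ 2 := by
      rw [← Real.rpow_natCast, ← Real.rpow_add ht]; norm_num
    have ht' : t ≠ 0 := ne_of_gt ht
    rw [e1, e2]
    field_simp
    ring
  pos := by
    filter_upwards [self_mem_nhdsWithin, tendsto_log_one_div_atTop.eventually_gt_atTop 0]
      with t ht hl using mul_pos (Real.rpow_pos_of_pos ht _) hl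
  exponent_ne := by norm_num
  tendsto_deriv := by
    have h1 : Tendsto (fun t : ℝ => Real.log t * t ^ (1 / 2 : ℝ)) (𝓝[>] 0) (𝓝 0) :=
      tendsto_log_mul_rpow_nhdsGT_zero (by norm_num)
    have h2 := (h1.div_const (-2)).sub (tendsto_rpow_nhdsGT_zero (r := 1 / 2) (by norm_num))
    rw [zero_div, sub_zero] at h2
    refine h2.congr' ?_
    filter_upwards [self_mem_nhdsWithin] with t ht
    have e1 : t ^ (1 / 2 : ℝ) = t ^ (2 - 1 : ℝ) * t ^ (-1 / 2 : ℝ) := by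
      rw [← Real.rpow_add ht]; norm_num
    rw [← mul_assoc, ← e1, one_div t, Real.log_inv]
    ring
  tendsto_rpow_div := by
    have h := (tendsto_rpow_nhdsGT_zero (r := 1 / 2) (by norm_num)).mul
      tendsto_log_one_div_atTop.inv_tendsto_atTop
    rw [zero_mul] at h
    refine h.congr' ?_
    filter_upwards [self_mem_nhdsWithin] with t ht
    have e1 : t ^ (1 : ℝ) = t ^ (1 / 2 : ℝ) * t ^ (1 / 2 : ℝ) := by
      rw [← Real.rpow_add ht]; norm_num
    have hp := Real.rpow_pos_of_pos ht (1 / 2)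
    rw [e1, Pi.inv_apply, mul_div_mul_left _ _ hp.ne']
    exact (div_eq_mul_inv _ _).symm

end HardyPotential

end

theorem theorem2p8 {N : ℕ} (hN : 2 ≤ N) (Ω : Set (EuclideanSpace ℝ (Fin N)))
    (hΩ : HardyPotential.IsBoundedSmoothDomain Ω) (μ : ℝ) :
    (μ < 1 / 4 →
      (∀ h, HardyPotential.IsSmallSubharmonic Ω μ h →
        HardyPotential.limsupRatio Ω h
          (fun x => HardyPotential.bdryDist Ω x ^ HardyPotential.betaPlus μ) < ⊤) ∧
      (∀ H, HardyPotential.IsLargeSubharmonic Ω μ H →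
        0 < HardyPotential.limsupRatio Ω H
          (fun x => HardyPotential.bdryDist Ω x ^ HardyPotential.betaMinus μ)) ∧
      (∃ h, HardyPotential.IsSmallSubharmonic Ω μ h ∧
        Tendsto (fun x => h x / HardyPotential.bdryDist Ω x ^ HardyPotential.betaPlus μ)
          (HardyPotential.toBdry Ω) (𝓝 1)) ∧
      (∃ H, HardyPotential.IsLargeSubharmonic Ω μ H ∧
        Tendsto (fun x => H x / HardyPotential.bdryDist Ω x ^ HardyPotential.betaMinus μ)
          (HardyPotential.toBdry Ω) (𝓝 1))) ∧
    (μ = 1 / 4 →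
      (∀ h, HardyPotential.IsSmallSubharmonic Ω μ h →
        HardyPotential.limsupRatio Ω h
          (fun x => HardyPotential.bdryDist Ω x ^ (1 / 2 : ℝ)) < ⊤) ∧
      (∀ H, HardyPotential.IsLargeSubharmonic Ω μ H →
        0 < HardyPotential.limsupRatio Ω H
          (fun x => HardyPotential.bdryDist Ω x ^ (1 / 2 : ℝ) *
            Real.log (1 / HardyPotential.bdryDist Ω x))) ∧
      (∃ h, HardyPotential.IsSmallSubharmonic Ω μ h ∧
        Tendsto (fun x => h x / HardyPotential.bdryDist Ω x ^ (1 / 2 : ℝ))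
          (HardyPotential.toBdry Ω) (𝓝 1)) ∧
      (∃ H, HardyPotential.IsLargeSubharmonic Ω μ H ∧
        Tendsto (fun x => H x / (HardyPotential.bdryDist Ω x ^ (1 / 2 : ℝ) *
            Real.log (1 / HardyPotential.bdryDist Ω x)))
          (HardyPotential.toBdry Ω) (𝓝 1))) := by
  constructor
  · intro hμ
    set s := Real.sqrt (1 / 4 - μ) with hs
    have hs0 : 0 < s := Real.sqrt_pos.2 (by linarith)
    have hs2 : s * s = 1 / 4 - μ := Real.mul_self_sqrt (by linarith)
    have hβp : HardyPotential.betaPlus μ = 1 / 2 + s := rfl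
    have hβm : HardyPotential.betaMinus μ = 1 / 2 - s := rfl
    have hp : HardyPotential.IsEulerProfile μ (fun t => t ^ HardyPotential.betaPlus μ) _ _ :=
      HardyPotential.isEulerProfile_rpow (e := 1 / 2) (by rw [hβp]; linear_combination hs2)
        (by norm_num) (by norm_num) (mul_ne_zero (by norm_num) (by rw [hβp]; exact ne_of_gt (by linarith)))
    -- the exponent shift must stay below the gap `2 s` between the two roots
    have he0 : 0 < min (1 / 2) s := lt_min (by norm_num) hs0
    have he1 : min (1 / 2) s < 1 := (min_le_left _ _).trans_lt (by norm_num)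
    have hes : min (1 / 2) s ≤ s := min_le_right _ _
    have hq : HardyPotential.IsEulerProfile μ (fun t => t ^ HardyPotential.betaMinus μ) _ _ :=
      HardyPotential.isEulerProfile_rpow (e := min (1 / 2) s)
        (by rw [hβm]; linear_combination hs2) he0 he1
        (mul_ne_zero he0.ne' (by rw [hβm]; exact ne_of_lt (by linarith)))
    have hpq : Tendsto (fun t : ℝ => t ^ HardyPotential.betaPlus μ / t ^ HardyPotential.betaMinus μ)
        (𝓝[>] 0) (𝓝 0) := by
      refine (HardyPotential.tendsto_rpow_nhdsGT_zero (r := 2 * s) (by positivity)).congr' ?_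
      filter_upwards [self_mem_nhdsWithin] with t ht
      rw [← Real.rpow_sub ht, hβp, hβm]
      ring_nf
    have key := HardyPotential.dichotomy_of_profiles hN hΩ hp hq hpq
    exact key
  · rintro rfl
    have hp : HardyPotential.IsEulerProfile (1 / 4) (fun t => t ^ (1 / 2 : ℝ)) _ _ :=
      HardyPotential.isEulerProfile_rpow (e := 1 / 2) (by norm_num) (by norm_num) (by norm_num)
        (by norm_num)
    have hpq : Tendsto (fun t : ℝ => t ^ (1 / 2 : ℝ) / (t ^ (1 / 2 : ℝ) * Real.log (1 / t)))
        (𝓝[>] 0) (𝓝 0) := by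
      refine HardyPotential.tendsto_log_one_div_atTop.inv_tendsto_atTop.congr' ?_
      filter_upwards [self_mem_nhdsWithin] with t ht
      have hpos := Real.rpow_pos_of_pos ht (1 / 2)
      rw [Pi.inv_apply, div_mul_cancel_left₀ hpos.ne']
    have key := HardyPotential.dichotomy_of_profiles hN hΩ hp
      HardyPotential.isEulerProfile_sqrt_log hpq
    exact key
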